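/- **Model.** Let $\lambda_1,\lambda_2,\theta_1,\theta_2>0$, let $\lambda_0,\mu_A\ge 0$ with $\lambda_0+\mu_A>0$, let $0<q_1,q_2<1$, and let $(g_{0,i})_{i\ge1}$ be a probability distribution on $\mathbb N^*=\{1,2,\dots\}$. For $m\in\{1,2\}$ let $g_{m,n}=q_m(1-q_m)^{n-1}$ ($n\ge1$) be the geometric distribution of limit-order sizes at the best quote ($m=1$) and inside the book ($m=2$), and let $A_m$ be the following infinitesimal generator on $\mathbb N^*$: from state $1+i$ ($i\ge 0$), jump to $1+i+n$ at rate $\lambda_m g_{m,n}$ ($n\ge1$), and to $i$ at rate $i\theta_m$ (each share except the last is cancelled at rate $\theta_m$; there are no partial market orders, i.e. $\mu=0$). The volume at the second limit is the continuous-time Markov chain on $\mathbb N^*$ with generator $A_2$; let $(\pi_{2,i})_{i\ge1}$ be its stationary distribution. The volume $X$ at the best quote is the continuous-time Markov chain on $\mathbb N^*$ that evolves with generator $A_1$ between price moves, and is reset to an independent random volume with distribution $(g_{0,i})$ at rate $\lambda_0$ (aggressive limit orders) and with distribution $(\pi_{2,i})$ at rate $\mu_A$ (aggressive market orders). Let $h_i=\frac{\lambda_0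 g_{0,i}+\mu_A\pi_{2,i}}{\lambda_0+\mu_A}$ be the distribution of the volume just after a price move. **Proposition (Model 1b).** Both generators determine a unique honest transition function, and each of the two chains has exactly one stationary distribution. (i) The stationary distribution of the second limit is the shifted negative binomial (Pólya) distribution with size parameter $r=\frac{\lambda_2}{(1-q_2)\theta_2}$ and probability parameter $q_2$: $$\pi_{2,i}=q_2^{\,r}\,\frac{(1-q_2)^{i-1}}{(i-1)!}\,\frac{\Gamma(i-1+r)}{\Gamma(r)},\qquad i\ge1,$$ and hence $$h_i=\frac{\lambda_0 g_{0,i}}{\mu_A+\lambda_0}+\frac{\mu_A}{\mu_A+\lambda_0}\,q_2^{\,r}\,\frac{(1-q_2)^{i-1}}{(i-1)!}\,\frac{\Gamma(i-1+r)}{\Gamma(r)},\qquad i\ge1.$$ (ii) The stationary distribution $(\pi_j)_{j\ge1}$ of $X$ is $$\begin{aligned} \pi_j=(\lambda_0+\mu_A)\Bigg[&\sum_{i=1}^\infty h_i\; q_1\frac{\lambda_1}{\theta_1}\sum_{k=0}^{\min(i-1,j-2)}\binom{i-1}{k}\frac{1}{(j-1-k)!}\sum_{l=0}^{j-2-k}\binom{j-2-k}{l}(-1)^l\\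 &\times\prod_{\alpha=1}^{l}\Big(\frac{\lambda_1}{\theta_1}-\alpha(1-q_1)\Big)\prod_{\beta=1}^{j-2-k-l}\Big(\frac{\lambda_1}{\theta_1}+\beta(1-q_1)\Big)\\ &\times\int_0^\infty(1-e^{-\theta_1t})^{i-k}e^{-(l+k)\theta_1t}\big[q_1+(1-q_1)e^{-\theta_1t}\big]^{\frac{\lambda_1}{\theta_1(1-q_1)}-l-1}e^{-(\lambda_0+\mu_A)t}\,dt\\ +&\sum_{i=j}^\infty h_i\binom{i-1}{j-1}\int_0^\infty e^{-(j-1)\theta_1t}(1-e^{-\theta_1t})^{i-j}\big[q_1+(1-q_1)e^{-\theta_1t}\big]^{\frac{\lambda_1}{\theta_1(1-q_1)}}e^{-(\lambda_0+\mu_A)t}\,dt\Bigg],\qquad j\ge1, \end{aligned}$$ where empty sums are $0$ and empty products are $1$, and all integrals and both series over $i$ converge absolutely. -/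

import Mathlib

open scoped NNReal Topology

noncomputable section

namespace OrderBook

/-- `p` is a probability distribution on the countable set `S`. -/
structure IsDistribution {S : Type} (p : S → ℝ) : Prop where
  nonneg : ∀ i, 0 ≤ p i
  hasSum_one : HasSum p 1

/-- `P` is the transition function `P t i j = ℙ(Z(s + t) = j | Z(s) = i)` of a continuous-time
Markov chain `Z` on `S` with infinitesimal generator (Q-matrix) `Q`: a semigroup of stochastic
matrices whose derivative at time zero is `Q`, entry by entry. -/
structure IsTransitionFunction {S : Type} [DecidableEq S] (Q : S → S → ℝ)
    (P : ℝ≥0 → S → S → ℝ) : Prop where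
  stochastic : ∀ t i, IsDistribution (P t i)
  zero : ∀ i j, P 0 i j = if i = j then 1 else 0
  chapman_kolmogorov : ∀ s t i j, HasSum (fun k => P s i k * P t k j) (P (s + t) i j)
  generator : ∀ i j,
    Filter.Tendsto (fun t : ℝ≥0 => (P t i j - P 0 i j) / (t : ℝ)) (𝓝[>] 0) (𝓝 (Q i j))

/-- `ν` is a stationary distribution of the Markov chain with transition function `P`. -/
structure IsStationary {S : Type} (P : ℝ≥0 → S → S → ℝ) (ν : S → ℝ) : Prop where
  distribution : IsDistribution ν
  invariant : ∀ t j, HasSum (fun i => ν i * P t i j) (ν j)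

/-- Generator of the queue `Y` on `ℕ`: batches arrive at rate `lam` with size distribution `g`
(supported on `n ≥ 1`), unit departures occur at rate `mu + i * theta` when `Y = i ≥ 1`. -/
def queueGenerator (lam mu theta : ℝ) (g : ℕ → ℝ) (i j : ℕ) : ℝ :=
  if i < j then lam * g (j - i)
  else if i = j then -(lam + if i = 0 then 0 else mu + i * theta)
  else if i = j + 1 then mu + i * theta
  else 0

/-- Generator on `{1, 2, 3, …}` of the volume `1 + Y` of a limit whose last share can be neither
cancelled nor matched by a partial market order. -/
def limitGenerator (lam mu theta : ℝ) (g : ℕ → ℝ) (i j : ℕ+) : ℝ :=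
  queueGenerator lam mu theta g i.natPred j.natPred

/-- Geometric distribution on `{1, 2, 3, …}`, with generating function `q z / (1 - (1 - q) z)`. -/
def geometricSize (q : ℝ) (n : ℕ) : ℝ :=
  if n = 0 then 0 else q * (1 - q) ^ (n - 1)

/-- Generator of the volume `X` at the best quote: between price moves, `X` evolves with generator
`A`; at rate `lam0` (aggressive limit orders) it is reset to a fresh random volume with
distribution `g0`, and at rate `muA` (aggressive market orders) to one with distribution `pi2`. -/
def bestQuoteGenerator (A : ℕ+ → ℕ+ → ℝ) (lam0 muA : ℝ) (g0 pi2 : ℕ+ → ℝ) (i j : ℕ+) : ℝ :=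
  A i j + lam0 * (g0 j - if i = j then 1 else 0) + muA * (pi2 j - if i = j then 1 else 0)

/-- Distribution of the volume at the best quote just after a price move. -/
def resetDistribution (lam0 muA : ℝ) (g0 pi2 : ℕ+ → ℝ) (i : ℕ+) : ℝ :=
  lam0 * g0 i / (lam0 + muA) + muA * pi2 i / (lam0 + muA)

/-- Negative binomial (Pólya) distribution on `ℕ` with real size parameter `r` and
probability parameter `q`. -/
def polya (r q : ℝ) (n : ℕ) : ℝ :=
  q ^ r * (1 - q) ^ n / (n.factorial : ℝ) * (Real.Gamma (n + r) / Real.Gamma r)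

/-- Integrand `(1-e^{-θt})^{i-k} e^{-(l+k)θt} [q+(1-q)e^{-θt}]^{lam/(θ(1-q))-l-1} e^{-βt}`. -/
def integrandArrival (lam theta q beta : ℝ) (i k l : ℕ) (t : ℝ) : ℝ :=
  (1 - Real.exp (-theta * t)) ^ (i - k) * Real.exp (-((l : ℝ) + k) * theta * t)
    * (q + (1 - q) * Real.exp (-theta * t)) ^ (lam / (theta * (1 - q)) - l - 1)
    * Real.exp (-beta * t)

/-- Integrand `e^{-(j-1)θt} (1-e^{-θt})^{i-j} [q+(1-q)e^{-θt}]^{lam/(θ(1-q))} e^{-βt}`. -/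
def integrandSurvival (lam theta q beta : ℝ) (i j : ℕ) (t : ℝ) : ℝ :=
  Real.exp (-((j : ℝ) - 1) * theta * t) * (1 - Real.exp (-theta * t)) ^ (i - j)
    * (q + (1 - q) * Real.exp (-theta * t)) ^ (lam / (theta * (1 - q)))
    * Real.exp (-beta * t)

/-- The factor of `h_i` in the first series of the formula for `π_j`. Here `k` ranges over
`0 ≤ k ≤ min (i-1) (j-2)` and `l` over `0 ≤ l ≤ j-2-k` (no `k` at all when `j = 1`). -/
def arrivalTerm (lam theta q beta : ℝ) (j i : ℕ) : ℝ :=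
  q * (lam / theta) * ∑ k ∈ Finset.range (min i (j - 1)),
    ((i - 1).choose k : ℝ) * (1 / ((j - 1 - k).factorial : ℝ)) *
      ∑ l ∈ Finset.range (j - 1 - k),
        ((j - 2 - k).choose l : ℝ) * (-1) ^ l
          * (∏ a ∈ Finset.Icc 1 l, (lam / theta - a * (1 - q)))
          * (∏ b ∈ Finset.Icc 1 (j - 2 - k - l), (lam / theta + b * (1 - q)))
          * ∫ t in Set.Ioi (0 : ℝ), integrandArrival lam theta q beta i k l t

/-- The factor of `h_i` in the second series (`i ≥ j`) of the formula for `π_j`. -/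
def survivalTerm (lam theta q beta : ℝ) (j i : ℕ) : ℝ :=
  ((i - 1).choose (j - 1) : ℝ) *
    ∫ t in Set.Ioi (0 : ℝ), integrandSurvival lam theta q beta i j t

end OrderBook

end

/-! Subtracting one from the volume turns each chain, between price moves, into an infinite-server
queue with geometric batches. Put c = 1 - q, r = λ/(θc) and x = e^{-θt}. Each initial share survives
to time t with probability x, and the batches form a compound Poisson input; from i shares the
length at time t therefore has generating function (1-x+xz)^i ((1-c+cx-cxz)/(1-cz))^r. The proof
takes the coefficients of this series as the definition of `kernel` and verifies what is needed:
they are nonnegative with sum one, the parameters x and y compose to xy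
(`hasSum_kernel_mul_kernel`), and the derivative at time zero is the Q-matrix (`hasDerivAt_kernel`).
As x tends to 0 the initial state is forgotten and the Pólya law remains, so it is the only
stationary law.

The two reset mechanisms together are one reset at rate β = λ₀ + μ_A to the law h. Conditioning on
the age of the last reset gives the transition function explicitly
(`isTransitionFunction_resetTransition`). Its unique stationary law is the law h evolved for an
exponential time of rate β (`isStationary_resetTransition_iff`). In the expansion of the kernel, the
terms where every share above the permanent one is an initial survivor give the second series of the
formula, and the others give the first.

Uniqueness of the transition functions is analytic. Entrywise differentiability at zero already
implies the backward equation (`IsTransitionFunction.hasDerivAt`), and a maximum principle with the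
Lyapunov function i + 1 shows that two solutions agree. As h may have infinite mean, i + 1 need not
be a Lyapunov function for the chain with resets; `IsLyapunov.transitionFunction_unique` first
transforms the resets away. -/

noncomputable section

namespace OrderBook

open Filter Set

/-- A stable conservative Q-matrix: nonnegative off the diagonal, with rows summing to zero. -/
structure IsConservative {S : Type} (Q : S → S → ℝ) : Prop where
  nonneg : ∀ i j, i ≠ j → 0 ≤ Q i j
  hasSum_zero : ∀ i, HasSum (Q i) 0

theorem IsDistribution.le_one {S : Type} {p : S → ℝ} (hp : IsDistribution p) (i : S) : p i ≤ 1 :=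
  le_hasSum hp.hasSum_one i fun j _ => hp.nonneg j

theorem IsDistribution.abs_le_one {S : Type} {p : S → ℝ} (hp : IsDistribution p) (i : S) :
    |p i| ≤ 1 := by
  rw [abs_of_nonneg (hp.nonneg i)]; exact hp.le_one i

theorem _root_.HasSum.of_forall_eq {S : Type} {f g : S → ℝ} {a : ℝ} (h : HasSum f a)
    (hfg : ∀ k, f k = g k) : HasSum g a := by
  rwa [← funext hfg]

theorem summable_mul_of_abs_le {S : Type} {a f : S → ℝ} (ha : Summable a) {B : ℝ}
    (hf : ∀ i, |f i| ≤ B) : Summable fun i => a i * f i := by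
  refine Summable.of_norm_bounded (ha.abs.mul_right B) fun i => ?_
  rw [Real.norm_eq_abs, abs_mul]
  exact mul_le_mul_of_nonneg_left (hf i) (abs_nonneg _)

theorem abs_tsum_mul_le {S : Type} {a f : S → ℝ} (ha : Summable a) {B : ℝ}
    (hf : ∀ i, |f i| ≤ B) : |∑' i, a i * f i| ≤ (∑' i, |a i|) * B := by
  rw [← tsum_mul_right, ← Real.norm_eq_abs]
  refine tsum_of_norm_bounded (ha.abs.mul_right B).hasSum fun i => ?_
  rw [Real.norm_eq_abs, abs_mul]
  exact mul_le_mul_of_nonneg_left (hf i) (abs_nonneg _)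

/-! ### Regularity of transition functions and the backward equation -/

namespace IsTransitionFunction

variable {S : Type} [DecidableEq S] {Q : S → S → ℝ} {P : ℝ≥0 → S → S → ℝ}

/-- Scheffé's argument. The difference has total sum zero, so its ℓ¹ norm is twice the mass of its
negative part. Off the diagonal the difference quotients are nonnegative, hence that part is
dominated by |Q i k|, and dominated convergence applies. -/
theorem tendsto_tsum_abs_sub (hP : IsTransitionFunction Q P) (hQ : IsConservative Q) (i : S) :
    Tendsto (fun s : ℝ≥0 => ∑' k, |(P s i k - P 0 i k) / (s : ℝ) - Q i k|) (𝓝[>] 0) (𝓝 0) := by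
  have hsum : ∀ s : ℝ≥0, HasSum (fun k => (P s i k - P 0 i k) / (s : ℝ) - Q i k) 0 := by
    intro s
    have := (((hP.stochastic s i).hasSum_one.sub (hP.stochastic 0 i).hasSum_one).div_const
      (s : ℝ)).sub (hQ.hasSum_zero i)
    simpa using this
  have hpos : Tendsto (fun s : ℝ≥0 => ∑' k, max (Q i k - (P s i k - P 0 i k) / (s : ℝ)) 0)
      (𝓝[>] 0) (𝓝 (∑' _ : S, (0 : ℝ))) := by
    have hb : Summable fun k => |Q i k| + (if k = i then 1 else 0) :=
      (hQ.hasSum_zero i).summable.abs.add (hasSum_ite_eq i 1).summable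
    refine tendsto_tsum_of_dominated_convergence hb (fun k => ?_) ?_
    · have := ((hP.generator i k).const_sub (Q i k)).max (tendsto_const_nhds (x := (0 : ℝ)))
      simpa using this
    · have h1 := (hP.generator i i).const_sub (Q i i)
      rw [sub_self] at h1
      have h2 := h1.eventually (Iic_mem_nhds (show (0 : ℝ) < 1 by norm_num))
      filter_upwards [h2] with s hs k
      rw [Real.norm_eq_abs, abs_of_nonneg (le_max_right _ _)]
      refine max_le ?_ (by split_ifs <;> positivity)
      by_cases hk : k = i
      · subst hk
        simp only [if_true]
        have : Q k k - (P s k k - P 0 k k) / (s : ℝ) ≤ 1 := hs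
        linarith [abs_nonneg (Q k k)]
      · have : 0 ≤ (P s i k - P 0 i k) / (s : ℝ) := by
          rw [hP.zero, if_neg (Ne.symm hk), sub_zero]
          exact div_nonneg ((hP.stochastic s i).nonneg k) s.2
        simp only [hk, if_false]
        linarith [le_abs_self (Q i k)]
  have heq : ∀ s : ℝ≥0, ∑' k, |(P s i k - P 0 i k) / (s : ℝ) - Q i k|
      = 2 * ∑' k, max (Q i k - (P s i k - P 0 i k) / (s : ℝ)) 0 := by
    intro s
    have h1 : ∀ k, max (Q i k - (P s i k - P 0 i k) / (s : ℝ)) 0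
        = (|(P s i k - P 0 i k) / (s : ℝ) - Q i k|
          - ((P s i k - P 0 i k) / (s : ℝ) - Q i k)) * (1 / 2) := by
      intro k
      rcases le_total (Q i k) ((P s i k - P 0 i k) / (s : ℝ)) with h | h
      · rw [max_eq_right (by linarith), abs_of_nonneg (by linarith)]; ring
      · rw [max_eq_left (by linarith), abs_of_nonpos (by linarith)]; ring
    have h2 := (((hsum s).summable.abs.hasSum.sub (hsum s)).mul_right (1 / 2)).tsum_eq
    simp only [h1]
    rw [h2]; ring
  simp only [heq]
  simpa using hpos.const_mul 2

/-- By Chapman–Kolmogorov the error is an ℓ¹-small row paired with a column of `P t`, whose entries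
are at most 1. Thus δ does not depend on t, which later gives the left derivative as well. -/
theorem uniform_right_derivative (hP : IsTransitionFunction Q P) (hQ : IsConservative Q) (i : S)
    {η : ℝ} (hη : 0 < η) : ∃ δ > 0, ∀ s : ℝ≥0, 0 < s → (s : ℝ) < δ → ∀ t j,
      |P (s + t) i j - P t i j - s * ∑' k, Q i k * P t k j| ≤ η * s := by
  have h := (hP.tendsto_tsum_abs_sub hQ i).eventually (Iio_mem_nhds hη)
  rw [eventually_nhdsWithin_iff, Metric.eventually_nhds_iff] at h
  obtain ⟨δ, hδ, h⟩ := h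
  refine ⟨δ, hδ, fun s hs hsδ t j => ?_⟩
  have hs' : (0 : ℝ) < s := hs
  have hlt := h (by rw [NNReal.dist_eq]; simpa using hsδ) hs
  have hsum : Summable fun k => (P s i k - P 0 i k) / (s : ℝ) - Q i k :=
    (((hP.stochastic s i).hasSum_one.sub (hP.stochastic 0 i).hasSum_one).div_const
      (s : ℝ)).summable.sub (hQ.hasSum_zero i).summable
  have hb : ∀ k, |P t k j| ≤ 1 := fun k => (hP.stochastic t k).abs_le_one j
  have h1 := abs_tsum_mul_le hsum hb
  have h2 : HasSum (fun k => ((P s i k - P 0 i k) / (s : ℝ) - Q i k) * P t k j)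
      ((P (s + t) i j - P t i j) / s - ∑' k, Q i k * P t k j) := by
    have h0 := hP.chapman_kolmogorov 0 t i j
    rw [zero_add] at h0
    have := (((hP.chapman_kolmogorov s t i j).sub h0).div_const (s : ℝ)).sub
      (summable_mul_of_abs_le (hQ.hasSum_zero i).summable hb).hasSum
    exact this.of_forall_eq fun k => by ring
  rw [h2.tsum_eq] at h1
  have h3 : P (s + t) i j - P t i j - s * ∑' k, Q i k * P t k j
      = s * ((P (s + t) i j - P t i j) / s - ∑' k, Q i k * P t k j) := by
    field_simp
  rw [h3, abs_mul, abs_of_pos hs', mul_comm η]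
  refine mul_le_mul_of_nonneg_left (h1.trans ?_) hs'.le
  rw [mul_one]; exact hlt.le

theorem continuous (hP : IsTransitionFunction Q P) (hQ : IsConservative Q) (i j : S) :
    Continuous fun t : ℝ≥0 => P t i j := by
  obtain ⟨δ, hδ, h⟩ := hP.uniform_right_derivative hQ i one_pos
  set C := ∑' k, |Q i k| with hC
  have hC0 : 0 ≤ C := tsum_nonneg fun k => abs_nonneg _
  have key : ∀ s : ℝ≥0, (s : ℝ) < δ → ∀ t, |P (s + t) i j - P t i j| ≤ (C + 1) * s := by
    intro s hs t
    rcases eq_or_lt_of_le (show 0 ≤ s from s.2) with h0 | h0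
    · simp [← h0]
    have h1 := h s h0 hs t j
    have h2 := abs_tsum_mul_le (f := fun k => P t k j) (hQ.hasSum_zero i).summable
      (fun k => (hP.stochastic t k).abs_le_one j)
    rw [mul_one] at h2
    have h3 : |(s : ℝ) * ∑' k, Q i k * P t k j| ≤ s * C := by
      rw [abs_mul, NNReal.abs_eq]; exact mul_le_mul_of_nonneg_left h2 s.2
    have h4 := abs_add_le (P (s + t) i j - P t i j - s * ∑' k, Q i k * P t k j)
      (s * ∑' k, Q i k * P t k j)
    rw [sub_add_cancel] at h4
    linarith
  rw [Metric.continuous_iff]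
  intro t ε hε
  refine ⟨min δ (ε / (C + 1)), lt_min hδ (by positivity), fun u hu => ?_⟩
  have h1 : dist u t < δ := hu.trans_le (min_le_left _ _)
  have h2 : (C + 1) * dist u t < ε := by
    have := hu.trans_le (min_le_right _ _)
    rw [lt_div_iff₀ (by positivity)] at this; linarith
  refine lt_of_le_of_lt ?_ h2
  rw [NNReal.dist_eq] at h1 ⊢
  rw [Real.dist_eq]
  rcases le_total t u with htu | htu
  · have hk := key (u - t)
    rw [NNReal.coe_sub htu] at hk
    have ha : |(u : ℝ) - t| = u - t := abs_of_nonneg (sub_nonneg.2 htu)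
    rw [ha] at h1 ⊢
    have := hk h1 t
    rwa [tsub_add_cancel_of_le htu] at this
  · have hk := key (t - u)
    rw [NNReal.coe_sub htu] at hk
    have ha : |(u : ℝ) - t| = t - u := by
      rw [abs_sub_comm]; exact abs_of_nonneg (sub_nonneg.2 htu)
    rw [ha] at h1 ⊢
    have := hk h1 u
    rw [tsub_add_cancel_of_le htu] at this
    rwa [abs_sub_comm]

theorem continuous_tsum_mul (hP : IsTransitionFunction Q P) (hQ : IsConservative Q) {a : S → ℝ}
    (ha : Summable a) (j : S) : Continuous fun t : ℝ≥0 => ∑' k, a k * P t k j := by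
  refine continuous_tsum (u := fun k => |a k|) (fun k => (hP.continuous hQ k j).const_mul _)
    ha.abs fun k t => ?_
  rw [Real.norm_eq_abs, abs_mul]
  exact mul_le_of_le_one_right (abs_nonneg _) ((hP.stochastic t k).abs_le_one j)

/-- The backward equation. -/
theorem hasDerivAt (hP : IsTransitionFunction Q P) (hQ : IsConservative Q) (i j : S) {t : ℝ}
    (ht : 0 < t) : HasDerivAt (fun u : ℝ => P u.toNNReal i j)
      (∑' k, Q i k * P t.toNNReal k j) t := by
  have hg : Continuous fun u : ℝ => ∑' k, Q i k * P u.toNNReal k j :=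
    (hP.continuous_tsum_mul hQ (hQ.hasSum_zero i).summable j).comp continuous_real_toNNReal
  rw [hasDerivAt_iff_isLittleO, Asymptotics.isLittleO_iff]
  intro c hc
  obtain ⟨δ, hδ, h⟩ := hP.uniform_right_derivative hQ i (half_pos hc)
  have hg' := (Metric.continuous_iff.1 hg) t (c / 2) (half_pos hc)
  obtain ⟨δ', hδ', hg'⟩ := hg'
  rw [Metric.eventually_nhds_iff]
  refine ⟨min t (min δ δ'), lt_min ht (lt_min hδ hδ'), fun u hu => ?_⟩
  have hut : dist u t < t := hu.trans_le (min_le_left _ _)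
  have huδ : dist u t < δ := hu.trans_le ((min_le_right _ _).trans (min_le_left _ _))
  have huδ' : dist u t < δ' := hu.trans_le ((min_le_right _ _).trans (min_le_right _ _))
  have hu0 : 0 < u := by
    rw [Real.dist_eq, abs_lt] at hut; linarith
  simp only [Real.norm_eq_abs, smul_eq_mul]
  -- For u < t the uniform estimate is based at u, and continuity of the right-hand side moves it
  -- from u to t. For u > t it is based at t directly.
  rcases lt_trichotomy u t with hlt | heq | hlt
  · have ha : |u - t| = t - u := by rw [abs_sub_comm]; exact abs_of_pos (sub_pos.2 hlt)
    rw [Real.dist_eq, ha] at huδ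
    have h1 := h (t - u).toNNReal (Real.toNNReal_pos.2 (sub_pos.2 hlt))
      (by rwa [Real.coe_toNNReal _ (sub_pos.2 hlt).le]) u.toNNReal j
    rw [← Real.toNNReal_add (sub_pos.2 hlt).le hu0.le, sub_add_cancel,
      Real.coe_toNNReal _ (sub_pos.2 hlt).le] at h1
    have h2 := (hg' u huδ').le
    rw [Real.dist_eq] at h2
    rw [ha]
    rw [abs_le] at h1 h2 ⊢
    constructor <;> nlinarith
  · simp [heq]
  · have ha : |u - t| = u - t := abs_of_pos (sub_pos.2 hlt)
    rw [Real.dist_eq, ha] at huδ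
    have h1 := h (u - t).toNNReal (Real.toNNReal_pos.2 (sub_pos.2 hlt))
      (by rwa [Real.coe_toNNReal _ (sub_pos.2 hlt).le]) t.toNNReal j
    rw [← Real.toNNReal_add (sub_pos.2 hlt).le ht.le, sub_add_cancel,
      Real.coe_toNNReal _ (sub_pos.2 hlt).le] at h1
    rw [ha]
    refine h1.trans ?_
    nlinarith [sub_pos.2 hlt]

end IsTransitionFunction

/-! ### Lyapunov functions and the maximum principle -/

/-- A Lyapunov function for the Q-matrix `A`, which rules out explosion. -/
structure IsLyapunov {S : Type} (A : S → S → ℝ) (V : S → ℝ) (c : ℝ) : Prop where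
  pos : ∀ i, 0 < V i
  finite : ∀ B, {i | V i ≤ B}.Finite
  summable : ∀ i, Summable fun k => A i k * V k
  le : ∀ i, ∑' k, A i k * V k ≤ c * V i

/-- Maximum principle for bounded solutions of the backward equation. -/
theorem IsLyapunov.nonpos_of_backward {S : Type} {A : S → S → ℝ} {V : S → ℝ} {c : ℝ}
    (hV : IsLyapunov A V c) (hc : 0 ≤ c) (hA : IsConservative A) {f : ℝ → S → ℝ} {T B : ℝ}
    (hT : 0 ≤ T) (hB : ∀ t ∈ Icc 0 T, ∀ i, |f t i| ≤ B)
    (hcont : ∀ i, ContinuousOn (fun t => f t i) (Icc 0 T))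
    (hderiv : ∀ t ∈ Ioc 0 T, ∀ i, HasDerivAt (fun u => f u i) (∑' k, A i k * f t k) t)
    (h0 : ∀ i, f 0 i = 0) (i : S) : f T i ≤ 0 := by
  by_contra! hpos
  -- The barrier ε e^{(c+1)t} V takes away only half of `f T i` at (T, i), so w stays positive
  -- there. The rate c + 1 instead of c makes the final contradiction strict.
  set ε := f T i / (2 * Real.exp ((c + 1) * T) * V i) with hε
  have hVi := hV.pos i
  have hε0 : 0 < ε := by positivity
  set w : ℝ → S → ℝ := fun t k => f t k - ε * Real.exp ((c + 1) * t) * V k with hw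
  have hwT : 0 < w T i := by
    have : ε * Real.exp ((c + 1) * T) * V i = f T i / 2 := by
      rw [hε]; field_simp
    simp only [hw, this]; linarith
  have hwcont : ∀ k, ContinuousOn (fun t => w t k) (Icc 0 T) := fun k =>
    (hcont k).sub (by fun_prop)
  have hfin := hV.finite (B / ε)
  have hTmem : T ∈ Icc 0 T := ⟨hT, le_rfl⟩
  -- outside a finite set of states, `w` is negative
  have hout : ∀ t ∈ Icc 0 T, ∀ k, 0 < w t k → k ∈ hfin.toFinset := by
    intro t ht k hk
    rw [Set.Finite.mem_toFinset, mem_ofPred_eq, le_div_iff₀ hε0]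
    have h1 := (le_abs_self _).trans (hB t ht k)
    have h2 : 1 ≤ Real.exp ((c + 1) * t) := Real.one_le_exp (mul_nonneg (by linarith) ht.1)
    have h3 : V k * ε ≤ ε * Real.exp ((c + 1) * t) * V k := by
      have := mul_le_mul_of_nonneg_left h2 (mul_pos hε0 (hV.pos k)).le
      linarith
    simp only [hw] at hk
    linarith
  choose τ hτ hτmax using fun k =>
    isCompact_Icc.exists_isMaxOn (nonempty_Icc.2 hT) (hwcont k)
  obtain ⟨m, hm, hmmax⟩ := hfin.toFinset.exists_max_image (fun k => w (τ k) k)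
    ⟨i, hout T hTmem i hwT⟩
  have hmpos : 0 < w (τ m) m :=
    hwT.trans_le ((hτmax i hTmem).trans (hmmax i (hout T hTmem i hwT)))
  have hmax : ∀ t ∈ Icc 0 T, ∀ k, w t k ≤ w (τ m) m := by
    intro t ht k
    by_cases hk : 0 < w t k
    · exact (hτmax k ht).trans (hmmax k (hout t ht k hk))
    · linarith
  set s := τ m with hs
  have hs0 : 0 < s := by
    rcases eq_or_lt_of_le (hτ m).1 with h | h
    · exfalso
      have : w s m < 0 := by
        rw [hs, ← h]
        simp only [hw, h0]
        have := mul_pos (mul_pos hε0 (Real.exp_pos ((c + 1) * 0))) (hV.pos m)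
        linarith
      linarith
    · exact h
  have hsT : s ≤ T := (hτ m).2
  -- the time derivative at the maximum
  have hd : HasDerivAt (fun u => w u m)
      (∑' k, A m k * f s k - ε * (Real.exp ((c + 1) * s) * (c + 1)) * V m) s := by
    refine (hderiv s ⟨hs0, hsT⟩ m).sub ?_
    have := (((hasDerivAt_id s).const_mul (c + 1)).exp.const_mul ε).mul_const (V m)
    simpa using this
  have hd0 : 0 ≤ ∑' k, A m k * f s k - ε * (Real.exp ((c + 1) * s) * (c + 1)) * V m := by
    -- Slopes from the left, because the maximum may be attained at s = T.
    have h1 := (hasDerivWithinAt_iff_tendsto_slope' (s := Iio s) (by simp)).1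
      (hd.hasDerivWithinAt (s := Iio s))
    refine ge_of_tendsto h1 ?_
    filter_upwards [Ioo_mem_nhdsLT hs0] with u hu
    rw [slope_def_field]
    exact div_nonneg_of_nonpos
      (sub_nonpos.2 (hmax u ⟨hu.1.le, hu.2.le.trans hsT⟩ m)) (by linarith [hu.2])
  -- the generator at the maximum
  have hsumf : Summable fun k => A m k * f s k :=
    summable_mul_of_abs_le (hA.hasSum_zero m).summable (hB s ⟨hs0.le, hsT⟩)
  set e := ε * Real.exp ((c + 1) * s) with he
  have he0 : 0 < e := by positivity
  have h1 : HasSum (fun k => A m k * (w s k - w s m))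
      (∑' k, A m k * f s k - e * (∑' k, A m k * V k) - 0 * w s m) := by
    have := ((hsumf.hasSum.sub ((hV.summable m).hasSum.mul_left e))).sub
      ((hA.hasSum_zero m).mul_right (w s m))
    exact this.of_forall_eq fun k => by simp only [hw, he]; ring
  have h2 : ∑' k, A m k * f s k - e * (∑' k, A m k * V k) - 0 * w s m ≤ 0 := by
    refine h1.nonpos fun k => ?_
    by_cases hk : m = k
    · simp [hk]
    · exact mul_nonpos_of_nonneg_of_nonpos (hA.nonneg m k hk)
        (sub_nonpos.2 (hmax s ⟨hs0.le, hsT⟩ k))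
  have h3 := mul_le_mul_of_nonneg_left (hV.le m) he0.le
  have h4 : 0 < e * V m := mul_pos he0 (hV.pos m)
  have h5 : ε * (Real.exp ((c + 1) * s) * (c + 1)) * V m = e * (c * V m) + e * V m := by
    rw [he]; ring
  linarith

theorem IsLyapunov.eq_zero_of_backward {S : Type} {A : S → S → ℝ} {V : S → ℝ} {c : ℝ}
    (hV : IsLyapunov A V c) (hc : 0 ≤ c) (hA : IsConservative A) {f : ℝ → S → ℝ} {T B : ℝ}
    (hT : 0 ≤ T) (hB : ∀ t ∈ Icc 0 T, ∀ i, |f t i| ≤ B)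
    (hcont : ∀ i, ContinuousOn (fun t => f t i) (Icc 0 T))
    (hderiv : ∀ t ∈ Ioc 0 T, ∀ i, HasDerivAt (fun u => f u i) (∑' k, A i k * f t k) t)
    (h0 : ∀ i, f 0 i = 0) (i : S) : f T i = 0 := by
  refine le_antisymm (hV.nonpos_of_backward hc hA hT hB hcont hderiv h0 i) ?_
  have := hV.nonpos_of_backward (f := fun t i => -f t i) hc hA hT (by simpa using hB)
    (fun i => (hcont i).neg) (fun t ht i => ?_) (fun i => by simp [h0]) i
  · linarith
  · simp only [mul_neg, tsum_neg]
    exact (hderiv t ht i).neg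

end OrderBook

/-! ### Uniqueness in the presence of resets -/

namespace OrderBook

open Filter Set MeasureTheory

/-- The Q-matrix `A` with additional resets at rate `β` to the distribution `h`. -/
def resetGenerator {S : Type} [DecidableEq S] (A : S → S → ℝ) (β : ℝ) (h : S → ℝ) (i j : S) : ℝ :=
  A i j + β * (h j - if i = j then 1 else 0)

theorem IsConservative.resetGenerator {S : Type} [DecidableEq S] {A : S → S → ℝ} {β : ℝ}
    {h : S → ℝ} (hA : IsConservative A) (hβ : 0 ≤ β) (hh : IsDistribution h) :
    IsConservative (resetGenerator A β h) where
  nonneg i j hij := by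
    simp only [OrderBook.resetGenerator, hij, if_false, sub_zero]
    exact add_nonneg (hA.nonneg i j hij) (mul_nonneg hβ (hh.nonneg j))
  hasSum_zero i := by
    have h1 : HasSum (fun j => if i = j then (1 : ℝ) else 0) 1 := by
      simpa [eq_comm] using hasSum_ite_eq i (1 : ℝ)
    simpa using! (hA.hasSum_zero i).add ((hh.hasSum_one.sub h1).mul_left β)

/-- Non-explosion of `A` makes the transition function of `A` with bounded resets unique. -/
theorem IsLyapunov.transitionFunction_unique {S : Type} [DecidableEq S] {A : S → S → ℝ} {V : S → ℝ}
    {c β : ℝ} {h : S → ℝ} {P P' : ℝ≥0 → S → S → ℝ} (hV : IsLyapunov A V c) (hc : 0 ≤ c)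
    (hA : IsConservative A) (hβ : 0 ≤ β) (hh : IsDistribution h)
    (hP : IsTransitionFunction (resetGenerator A β h) P)
    (hP' : IsTransitionFunction (resetGenerator A β h) P') : P = P' := by
  have hQ := hA.resetGenerator hβ hh
  suffices H : ∀ (j : S) (T : ℝ), 0 ≤ T → ∀ i, P T.toNNReal i j - P' T.toNNReal i j = 0 by
    funext t i j
    have := H j t t.2 i
    rw [Real.toNNReal_coe] at this
    linarith
  intro j
  set f : ℝ → S → ℝ := fun t i => P t.toNNReal i j - P' t.toNNReal i j with hf
  have hfb : ∀ t i, |f t i| ≤ 2 := fun t i => by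
    have h1 := (hP.stochastic t.toNNReal i).abs_le_one j
    have h2 := (hP'.stochastic t.toNNReal i).abs_le_one j
    have := abs_sub (P t.toNNReal i j) (P' t.toNNReal i j)
    simp only [hf]; linarith
  have hfc : ∀ i, Continuous fun t => f t i := fun i =>
    ((hP.continuous hQ i j).comp continuous_real_toNNReal).sub
      ((hP'.continuous hQ i j).comp continuous_real_toNNReal)
  have hf0 : ∀ i, f 0 i = 0 := fun i => by simp [hf, hP.zero, hP'.zero]
  have hsumA : ∀ t i, Summable fun k => A i k * f t k := fun t i =>
    summable_mul_of_abs_le (hA.hasSum_zero i).summable (hfb t)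
  have hsumh : ∀ t, Summable fun k => h k * f t k := fun t =>
    summable_mul_of_abs_le hh.hasSum_one.summable (hfb t)
  set κ : ℝ → ℝ := fun t => ∑' k, h k * f t k with hκ
  have hκc : Continuous κ := by
    refine continuous_tsum (u := fun k => |h k| * 2) (fun k => (hfc k).const_mul _)
      (hh.hasSum_one.summable.abs.mul_right 2) fun k t => ?_
    rw [Real.norm_eq_abs, abs_mul]
    exact mul_le_mul_of_nonneg_left (hfb t k) (abs_nonneg _)
  have hfd : ∀ t, 0 < t → ∀ i, HasDerivAt (fun u => f u i)
      (∑' k, A i k * f t k + β * (κ t - f t i)) t := by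
    intro t ht i
    have h1 := (hP.hasDerivAt hQ i j ht).sub (hP'.hasDerivAt hQ i j ht)
    have h2 : HasSum (fun k => OrderBook.resetGenerator A β h i k * f t k)
        (∑' k, A i k * f t k + β * (κ t - f t i)) := by
      have h3 : HasSum (fun k => if k = i then f t i else 0) (f t i) := hasSum_ite_eq i _
      refine ((hsumA t i).hasSum.add (((hsumh t).hasSum.sub h3).mul_left β)).of_forall_eq
        fun k => ?_
      simp only [OrderBook.resetGenerator]
      by_cases hk : k = i
      · subst hk; simp; ring
      · simp [hk, Ne.symm hk]; ring
    have h4 := (summable_mul_of_abs_le (hQ.hasSum_zero i).summable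
      fun k => (hP.stochastic t.toNNReal k).abs_le_one j).hasSum.sub
      (summable_mul_of_abs_le (hQ.hasSum_zero i).summable
      fun k => (hP'.stochastic t.toNNReal k).abs_le_one j).hasSum
    have h5 := (h4.of_forall_eq fun k => (mul_sub _ _ _).symm).unique h2
    rw [h5] at h1
    exact h1
  -- remove the reset term
  set D : ℝ → ℝ := fun t => ∫ s in (0 : ℝ)..t, β * (Real.exp (β * s) * κ s) with hD
  have hgc : Continuous fun s => β * (Real.exp (β * s) * κ s) := by fun_prop
  have hDd : ∀ t, HasDerivAt D (β * (Real.exp (β * t) * κ t)) t := fun t =>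
    intervalIntegral.integral_hasDerivAt_right (hgc.intervalIntegrable _ _)
      (hgc.stronglyMeasurableAtFilter _ _) hgc.continuousAt
  have hDc : Continuous D := continuous_iff_continuousAt.2 fun t => (hDd t).continuousAt
  -- Resets contribute β(κ - f) to the backward equation. The factor e^{βt} cancels -βf, and `D`
  -- absorbs the term in κ; being independent of the state, `D` is annihilated by the conservative
  -- `A`. What is left is a bounded solution for `A` alone with zero initial value.
  have hψ : ∀ T, 0 ≤ T → ∀ i, Real.exp (β * T) * f T i - D T = 0 := by
    intro T hT i
    obtain ⟨B, hB⟩ := isCompact_Icc.exists_bound_of_continuousOn (s := Icc 0 T) hDc.continuousOn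
    refine hV.eq_zero_of_backward (f := fun t i => Real.exp (β * t) * f t i - D t)
      (B := Real.exp (β * T) * 2 + B) hc hA hT ?_ ?_ ?_ ?_ i
    · intro t ht k
      refine (abs_sub _ _).trans (add_le_add ?_ (hB t ht))
      rw [abs_mul, Real.abs_exp]
      exact mul_le_mul (Real.exp_le_exp.2 (mul_le_mul_of_nonneg_left ht.2 hβ)) (hfb t k)
        (abs_nonneg _) (Real.exp_pos _).le
    · intro k
      have := hfc k
      fun_prop
    · intro t ht k
      have he : HasDerivAt (fun u => Real.exp (β * u)) (Real.exp (β * t) * β) t := by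
        simpa using ((hasDerivAt_id t).const_mul β).exp
      have h1 := (he.mul (hfd t ht.1 k)).sub (hDd t)
      have h2 : HasSum (fun l => A k l * (Real.exp (β * t) * f t l - D t))
          (Real.exp (β * t) * β * f t k + Real.exp (β * t) *
            (∑' l, A k l * f t l + β * (κ t - f t k)) - β * (Real.exp (β * t) * κ t)) := by
        have := ((hsumA t k).hasSum.mul_left (Real.exp (β * t))).sub
          ((hA.hasSum_zero k).mul_right (D t))
        have e : Real.exp (β * t) * β * f t k + Real.exp (β * t) *
            (∑' l, A k l * f t l + β * (κ t - f t k)) - β * (Real.exp (β * t) * κ t)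
            = Real.exp (β * t) * ∑' l, A k l * f t l - 0 * D t := by ring
        rw [e]
        exact this.of_forall_eq fun l => by ring
      rw [h2.tsum_eq]
      exact h1
    · intro k
      simp [hf0, hD]
  -- Averaging the previous identity over h closes the system: D' = βD with D(0) = 0, so `D`
  -- vanishes.
  have hκD : ∀ t, 0 ≤ t → Real.exp (β * t) * κ t = D t := by
    intro t ht
    have h1 := (hsumh t).hasSum.mul_left (Real.exp (β * t))
    have h2 := hh.hasSum_one.mul_right (D t)
    rw [one_mul] at h2
    refine h1.unique (h2.of_forall_eq fun k => ?_)
    rw [← sub_eq_zero.1 (hψ t ht k)]; ring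
  have hD0 : ∀ T, 0 ≤ T → D T = 0 := by
    intro T hT
    have h1 := constant_of_has_deriv_right_zero (f := fun t => Real.exp (-β * t) * D t)
      (a := 0) (b := T) (by fun_prop) (fun t ht => by
        have he : HasDerivAt (fun u => Real.exp (-β * u)) (Real.exp (-β * t) * -β) t := by
          simpa using ((hasDerivAt_id t).const_mul (-β)).exp
        have := he.mul (hDd t)
        rw [hκD t ht.1] at this
        have e : Real.exp (-β * t) * -β * D t + Real.exp (-β * t) * (β * D t) = 0 := by ring
        rw [e] at this
        exact this.hasDerivWithinAt) T ⟨hT, le_rfl⟩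
    have h2 : D 0 = 0 := by simp [hD]
    simp only [h2, mul_zero] at h1
    exact (mul_eq_zero.1 h1).resolve_left (Real.exp_pos _).ne'
  intro T hT i
  have h1 := hψ T hT i
  rw [hD0 T hT, sub_zero] at h1
  exact (mul_eq_zero.1 h1).resolve_left (Real.exp_pos _).ne'

/-- Fubini: the joint weights a i * F i k are summable over pairs, and a bounded g preserves this.
-/
theorem hasSum_mixture {S : Type} {a g : S → ℝ} {F : S → S → ℝ} {B : ℝ} (ha : IsDistribution a)
    (hF : ∀ i, IsDistribution (F i)) (hg : ∀ k, |g k| ≤ B) :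
    HasSum (fun k => (∑' i, a i * F i k) * g k) (∑' i, a i * ∑' k, F i k * g k) := by
  have h1 : Summable fun p : S × S => a p.1 * F p.1 p.2 := by
    refine (summable_prod_of_nonneg
      (fun p => mul_nonneg (ha.nonneg _) ((hF _).nonneg _))).2 ⟨fun i => ?_, ?_⟩
    · exact (hF i).hasSum_one.summable.mul_left (a i)
    · simp only [tsum_mul_left, fun i => (hF i).hasSum_one.tsum_eq, mul_one]
      exact ha.hasSum_one.summable
  have h2 : Summable fun p : S × S => a p.1 * F p.1 p.2 * g p.2 :=
    summable_mul_of_abs_le (f := fun p : S × S => g p.2) h1 fun p => hg p.2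
  have h3 : ∑' p : S × S, a p.1 * F p.1 p.2 * g p.2 = ∑' i, a i * ∑' k, F i k * g k := by
    rw [h2.tsum_prod]
    simp only [mul_assoc, tsum_mul_left]
  rw [← h3]
  have h4 := (Equiv.prodComm S S).hasSum_iff.2 h2.hasSum
  refine h4.prod_fiberwise fun k => ?_
  have h5 : Summable fun i => a i * F i k := h1.prod_symm.prod_factor k
  simpa using h5.hasSum.mul_right (g k)

/-- For nonnegative terms the series is its own dominating series. -/
theorem hasSum_integral_of_nonneg {S α : Type} [Countable S] [MeasurableSpace α] {μ : Measure α}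
    {F : S → α → ℝ} {G : α → ℝ} (hFm : ∀ k, AEStronglyMeasurable (F k) μ)
    (hF0 : ∀ᵐ s ∂μ, ∀ k, 0 ≤ F k s) (hG : Integrable G μ)
    (h : ∀ᵐ s ∂μ, HasSum (fun k => F k s) (G s)) :
    HasSum (fun k => ∫ s, F k s ∂μ) (∫ s, G s ∂μ) := by
  refine hasSum_integral_of_dominated_convergence F hFm (fun k => ?_) ?_ ?_ h
  · filter_upwards [hF0] with s hs
    rw [Real.norm_eq_abs, abs_of_nonneg (hs k)]
  · filter_upwards [h] with s hs using hs.summable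
  · refine hG.congr ?_
    filter_upwards [h] with s hs using hs.tsum_eq.symm

theorem tendsto_coe_nhdsGT_zero : Tendsto (fun t : ℝ≥0 => (t : ℝ)) (𝓝[>] 0) (𝓝[>] 0) := by
  refine tendsto_nhdsWithin_of_tendsto_nhds_of_eventually_within _ ?_ ?_
  · exact (NNReal.continuous_coe.tendsto 0).mono_left nhdsWithin_le_nhds
  · filter_upwards [self_mem_nhdsWithin] with t ht using NNReal.coe_pos.2 ht

theorem _root_.HasDerivAt.tendsto_div_nhdsGT_zero {f : ℝ → ℝ} {f' : ℝ} (hf : HasDerivAt f f' 0) :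
    Tendsto (fun t : ℝ≥0 => (f t - f 0) / t) (𝓝[>] 0) (𝓝 f') := by
  have := ((hasDerivWithinAt_iff_tendsto_slope' (s := Ioi 0) (by simp)).1
    hf.hasDerivWithinAt).comp tendsto_coe_nhdsGT_zero
  refine this.congr fun t => ?_
  simp [slope_def_field]

/-- Law at time `t` of the chain with transition function `P` and initial distribution `h`. -/
def lawAt {S : Type} (P : ℝ≥0 → S → S → ℝ) (h : S → ℝ) (t : ℝ≥0) (j : S) : ℝ :=
  ∑' k, h k * P t k j

/-- Density in `s` of the event that the last reset is `s` units of time old and the state is `j`. -/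
def ageDensity {S : Type} (P : ℝ≥0 → S → S → ℝ) (h : S → ℝ) (β : ℝ) (j : S) (s : ℝ) : ℝ :=
  β * Real.exp (-β * s) * lawAt P h s.toNNReal j

/-- Transition function of the chain with resets at rate `β` to the distribution `h`. -/
def resetTransition {S : Type} (P : ℝ≥0 → S → S → ℝ) (h : S → ℝ) (β : ℝ) (t : ℝ≥0) (i j : S) : ℝ :=
  Real.exp (-β * t) * P t i j + ∫ s in (0 : ℝ)..t, ageDensity P h β j s

/-- Stationary distribution of the chain with resets at rate `β` to the distribution `h`. -/
def resetStationary {S : Type} (P : ℝ≥0 → S → S → ℝ) (h : S → ℝ) (β : ℝ) (j : S) : ℝ :=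
  ∫ s in Ioi (0 : ℝ), ageDensity P h β j s

/-! ### Transition function and stationary law of a chain with resets -/

section Reset

variable {S : Type} [DecidableEq S] {A : S → S → ℝ} {P : ℝ≥0 → S → S → ℝ} {h : S → ℝ} {β : ℝ}

theorem isDistribution_lawAt (hP : IsTransitionFunction A P) (hh : IsDistribution h) (t : ℝ≥0) :
    IsDistribution (lawAt P h t) where
  nonneg j := tsum_nonneg fun k => mul_nonneg (hh.nonneg k) ((hP.stochastic t k).nonneg j)
  hasSum_one := by
    have := hasSum_mixture (g := fun _ => 1) (B := 1) hh (hP.stochastic t) (by simp)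
    simpa [(hP.stochastic t _).hasSum_one.tsum_eq, hh.hasSum_one.tsum_eq] using! this

theorem hasSum_lawAt_mul (hP : IsTransitionFunction A P) (hh : IsDistribution h) (s t : ℝ≥0)
    (j : S) : HasSum (fun k => lawAt P h s k * P t k j) (lawAt P h (s + t) j) := by
  have := hasSum_mixture (g := fun k => P t k j) hh (hP.stochastic s)
    fun k => (hP.stochastic t k).abs_le_one j
  simp only [fun i => (hP.chapman_kolmogorov s t i j).tsum_eq] at this
  exact this

theorem lawAt_zero (hP : IsTransitionFunction A P) (j : S) : lawAt P h 0 j = h j := by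
  have : HasSum (fun k => h k * P 0 k j) (h j) := by
    simp only [hP.zero]
    exact (hasSum_ite_eq j (h j)).of_forall_eq fun k => by split_ifs with hk <;> simp [hk]
  exact this.tsum_eq

theorem continuous_ageDensity (hP : IsTransitionFunction A P) (hA : IsConservative A)
    (hh : IsDistribution h) (j : S) : Continuous (ageDensity P h β j) := by
  have := (hP.continuous_tsum_mul hA hh.hasSum_one.summable j).comp continuous_real_toNNReal
  exact Continuous.mul (by fun_prop) this

theorem ageDensity_nonneg (hP : IsTransitionFunction A P) (hh : IsDistribution h) (hβ : 0 < β)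
    (j : S) (s : ℝ) : 0 ≤ ageDensity P h β j s :=
  mul_nonneg (by positivity) ((isDistribution_lawAt hP hh _).nonneg j)

theorem ageDensity_le (hP : IsTransitionFunction A P) (hh : IsDistribution h) (hβ : 0 < β)
    (j : S) (s : ℝ) : ageDensity P h β j s ≤ β * Real.exp (-β * s) :=
  mul_le_of_le_one_right (by positivity) ((isDistribution_lawAt hP hh _).le_one j)

theorem hasSum_ageDensity (hP : IsTransitionFunction A P) (hh : IsDistribution h) (s : ℝ) :
    HasSum (fun j => ageDensity P h β j s) (β * Real.exp (-β * s)) := by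
  have := (isDistribution_lawAt hP hh s.toNNReal).hasSum_one.mul_left (β * Real.exp (-β * s))
  rwa [mul_one] at this

/-- Evolving for a time t without reset makes the age s + t; the factor e^{βt} undoes the additional
discount contained in the density at s + t. -/
theorem hasSum_ageDensity_mul (hP : IsTransitionFunction A P) (hh : IsDistribution h) (t : ℝ≥0)
    (j : S) {s : ℝ} (hs : 0 ≤ s) : HasSum (fun k => ageDensity P h β k s * P t k j)
      (Real.exp (β * t) * ageDensity P h β j (s + t)) := by
  have h1 := (hasSum_lawAt_mul hP hh s.toNNReal t j).mul_left (β * Real.exp (-β * s))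
  have h2 : Real.exp (β * t) * ageDensity P h β j (s + t)
      = β * Real.exp (-β * s) * lawAt P h (s.toNNReal + t) j := by
    rw [ageDensity, Real.toNNReal_add hs t.coe_nonneg, Real.toNNReal_coe,
      show -β * (s + t) = -β * s - β * t by ring, Real.exp_sub]
    field_simp
  rw [h2]
  exact h1.of_forall_eq fun k => by simp only [ageDensity]; ring

theorem integrableOn_ageDensity (hP : IsTransitionFunction A P) (hA : IsConservative A)
    (hh : IsDistribution h) (hβ : 0 < β) (j : S) (a : ℝ) :
    IntegrableOn (ageDensity P h β j) (Ioi a) := by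
  refine Integrable.mono' ((exp_neg_integrableOn_Ioi a hβ).const_mul β)
    (continuous_ageDensity hP hA hh j).aestronglyMeasurable (ae_of_all _ fun s => ?_)
  rw [Real.norm_eq_abs, abs_of_nonneg (ageDensity_nonneg hP hh hβ j s)]
  exact ageDensity_le hP hh hβ j s

theorem hasSum_setIntegral_ageDensity_mul [Countable S] (hP : IsTransitionFunction A P)
    (hA : IsConservative A) (hh : IsDistribution h) (hβ : 0 < β) (t : ℝ≥0) (j : S) {B : Set ℝ}
    (hB : MeasurableSet B) (hB0 : ∀ s ∈ B, 0 ≤ s)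
    (hint : IntegrableOn (fun s => ageDensity P h β j (s + t)) B) :
    HasSum (fun k => (∫ s in B, ageDensity P h β k s) * P t k j)
      (Real.exp (β * t) * ∫ s in B, ageDensity P h β j (s + t)) := by
  have := hasSum_integral_of_nonneg (μ := volume.restrict B)
    (F := fun k s => ageDensity P h β k s * P t k j)
    (G := fun s => Real.exp (β * t) * ageDensity P h β j (s + t))
    (fun k => ((continuous_ageDensity hP hA hh k).mul_const _).aestronglyMeasurable)
    (ae_of_all _ fun s k => mul_nonneg (ageDensity_nonneg hP hh hβ k s)
      ((hP.stochastic t k).nonneg j)) (hint.const_mul _)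
    ((ae_restrict_iff' hB).2 (ae_of_all _ fun s hs =>
      hasSum_ageDensity_mul hP hh t j (hB0 s hs)))
  simpa only [integral_mul_const, integral_const_mul] using this

theorem hasSum_setIntegral_ageDensity [Countable S] (hP : IsTransitionFunction A P)
    (hA : IsConservative A) (hh : IsDistribution h) (hβ : 0 < β) {B : Set ℝ}
    (hint : IntegrableOn (fun s => β * Real.exp (-β * s)) B) :
    HasSum (fun k => ∫ s in B, ageDensity P h β k s) (∫ s in B, β * Real.exp (-β * s)) :=
  hasSum_integral_of_nonneg
    (fun k => (continuous_ageDensity hP hA hh k).aestronglyMeasurable)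
    (ae_of_all _ fun s k => ageDensity_nonneg hP hh hβ k s) hint
    (ae_of_all _ fun s => hasSum_ageDensity hP hh s)

theorem hasSum_intervalIntegral_ageDensity [Countable S] (hP : IsTransitionFunction A P)
    (hA : IsConservative A) (hh : IsDistribution h) (hβ : 0 < β) (t : ℝ≥0) :
    HasSum (fun k => ∫ s in (0 : ℝ)..t, ageDensity P h β k s) (1 - Real.exp (-β * t)) := by
  have hc : Continuous fun s : ℝ => β * Real.exp (-β * s) := by fun_prop
  have h1 := hasSum_setIntegral_ageDensity hP hA hh hβ (B := Ioc 0 (t : ℝ))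
    (hc.integrableOn_Ioc)
  simp only [← intervalIntegral.integral_of_le t.coe_nonneg] at h1
  have h2 : ∫ s in (0 : ℝ)..t, β * Real.exp (-β * s) = 1 - Real.exp (-β * t) := by
    have := intervalIntegral.integral_eq_sub_of_hasDerivAt (a := 0) (b := (t : ℝ))
      (f := fun s => -Real.exp (-β * s)) (f' := fun s => β * Real.exp (-β * s))
      (fun s _ => by
        have := (((hasDerivAt_id s).const_mul (-β)).exp).neg
        simp only [id, mul_one] at this
        convert! this using 1; ring) (hc.intervalIntegrable _ _)
    rw [this]; simp; ring
  rwa [h2] at h1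

theorem isTransitionFunction_resetTransition [Countable S] (hP : IsTransitionFunction A P)
    (hA : IsConservative A) (hh : IsDistribution h) (hβ : 0 < β) :
    IsTransitionFunction (resetGenerator A β h) (resetTransition P h β) where
  stochastic t i :=
    { nonneg := fun j => add_nonneg
        (mul_nonneg (Real.exp_pos _).le ((hP.stochastic t i).nonneg j))
        (intervalIntegral.integral_nonneg t.2 fun s _ => ageDensity_nonneg hP hh hβ j s)
      hasSum_one := by
        have := ((hP.stochastic t i).hasSum_one.mul_left (Real.exp (-β * t))).add
          (hasSum_intervalIntegral_ageDensity hP hA hh hβ t)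
        rw [mul_one, add_sub_cancel] at this
        exact this }
  zero i j := by simp [resetTransition, hP.zero]
  chapman_kolmogorov s t i j := by
    have hc := continuous_ageDensity (β := β) hP hA hh j
    have hct : Continuous fun u : ℝ => ageDensity P h β j (u + t) := by fun_prop
    -- Three cases: no reset at all (`h1`), the last reset in the first stretch, hence of final age
    -- between t and s + t (`h2`), and a reset in the second stretch, which makes the state at time
    -- s irrelevant (`h3`).
    have h1 := (hP.chapman_kolmogorov s t i j).mul_left (Real.exp (-β * s) * Real.exp (-β * t))
    have h2 := (hasSum_setIntegral_ageDensity_mul hP hA hh hβ t j (B := Ioc 0 (s : ℝ))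
      measurableSet_Ioc (fun u hu => hu.1.le) hct.integrableOn_Ioc).mul_left (Real.exp (-β * t))
    simp only [← intervalIntegral.integral_of_le s.coe_nonneg] at h2
    have h3 := (((hP.stochastic s i).hasSum_one.mul_left (Real.exp (-β * s))).add
      (hasSum_intervalIntegral_ageDensity hP hA hh hβ s)).mul_right
        (∫ u in (0 : ℝ)..t, ageDensity P h β j u)
    have h4 := (h1.add h2).add h3
    have e : Real.exp (-β * s) * Real.exp (-β * t) * P (s + t) i j
        + Real.exp (-β * t) * (Real.exp (β * t) * ∫ u in (0 : ℝ)..s, ageDensity P h β j (u + t))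
        + (Real.exp (-β * s) * 1 + (1 - Real.exp (-β * s))) *
          (∫ u in (0 : ℝ)..t, ageDensity P h β j u) = resetTransition P h β (s + t) i j := by
      rw [intervalIntegral.integral_comp_add_right (ageDensity P h β j), ← mul_assoc,
        ← Real.exp_add, ← Real.exp_add, resetTransition, zero_add, NNReal.coe_add,
        ← intervalIntegral.integral_add_adjacent_intervals (hc.intervalIntegrable 0 t)
          (hc.intervalIntegrable t (s + t))]
      rw [show -β * (s + t : ℝ) = -β * s + -β * t by ring, show -β * (t : ℝ) + β * t = 0 by ring,
        Real.exp_zero]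
      ring
    rw [e] at h4
    exact h4.of_forall_eq fun k => by simp only [resetTransition]; ring
  generator i j := by
    have hexp : HasDerivAt (fun t : ℝ => Real.exp (-β * t)) (-β) 0 := by
      simpa using (((hasDerivAt_id (0 : ℝ)).const_mul (-β)).exp)
    have hexp' : Tendsto (fun t : ℝ≥0 => (Real.exp (-β * t) - 1) / t) (𝓝[>] 0) (𝓝 (-β)) := by
      simpa using hexp.tendsto_div_nhdsGT_zero
    have hc := continuous_ageDensity (β := β) hP hA hh j
    have hint : HasDerivAt (fun t : ℝ => ∫ s in (0 : ℝ)..t, ageDensity P h β j s) (β * h j) 0 := by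
      have := intervalIntegral.integral_hasDerivAt_right (hc.intervalIntegrable 0 0)
        (hc.stronglyMeasurableAtFilter _ _) hc.continuousAt
      simpa [ageDensity, lawAt_zero hP] using this
    have hint' : Tendsto (fun t : ℝ≥0 => (∫ s in (0 : ℝ)..t, ageDensity P h β j s) / t)
        (𝓝[>] 0) (𝓝 (β * h j)) := by
      simpa using hint.tendsto_div_nhdsGT_zero
    have hone : Tendsto (fun t : ℝ≥0 => Real.exp (-β * t)) (𝓝[>] 0) (𝓝 1) := by
      have : Continuous fun t : ℝ≥0 => Real.exp (-β * t) := by fun_prop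
      have := (this.tendsto 0).mono_left (nhdsWithin_le_nhds (s := Ioi 0))
      simpa using this
    -- Difference form of the product rule: e^{-βt}(P_t - P_0) + (e^{-βt} - 1)P_0, plus the
    -- integral.
    have := ((hone.mul (hP.generator i j)).add (hexp'.mul_const (P 0 i j))).add hint'
    have e : 1 * A i j + -β * P 0 i j + β * h j = resetGenerator A β h i j := by
      rw [resetGenerator, hP.zero]; ring
    rw [e] at this
    refine this.congr fun t => ?_
    simp only [resetTransition, NNReal.coe_zero, mul_zero, Real.exp_zero,
      intervalIntegral.integral_same]
    ring

/-- Letting t tend to infinity in the invariance relation, the term without reset is at most e^{-βt}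
and dies, so ν must be the full age integral. Conversely, one step of length t shifts the ages of
that integral by t, and the integral over (0, t) fills the gap. No ergodicity of the chain without
resets is needed. -/
theorem isStationary_resetTransition_iff [Countable S] (hP : IsTransitionFunction A P)
    (hA : IsConservative A) (hh : IsDistribution h) (hβ : 0 < β) (ν : S → ℝ) :
    IsStationary (resetTransition P h β) ν ↔ ν = resetStationary P h β := by
  have key : ∀ {ν : S → ℝ}, IsDistribution ν → ∀ t j, HasSum
      (fun i => ν i * resetTransition P h β t i j)
      (Real.exp (-β * t) * (∑' i, ν i * P t i j) + ∫ s in (0 : ℝ)..t, ageDensity P h β j s) := by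
    intro ν hν t j
    have h1 := ((summable_mul_of_abs_le hν.hasSum_one.summable fun i =>
      (hP.stochastic t i).abs_le_one j).hasSum.mul_left (Real.exp (-β * t))).add
      (hν.hasSum_one.mul_right (∫ s in (0 : ℝ)..t, ageDensity P h β j s))
    rw [one_mul] at h1
    exact h1.of_forall_eq fun i => by simp only [resetTransition]; ring
  constructor
  · intro hν
    funext j
    have h1 : ∀ t : ℝ≥0, ν j = Real.exp (-β * t) * (∑' i, ν i * P t i j)
        + ∫ s in (0 : ℝ)..t, ageDensity P h β j s := fun t =>
      (hν.invariant t j).unique (key hν.distribution t j)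
    have hcoe : Tendsto (fun t : ℝ≥0 => (t : ℝ)) atTop atTop := NNReal.tendsto_coe_atTop.2 tendsto_id
    have h2 := intervalIntegral_tendsto_integral_Ioi 0
      (integrableOn_ageDensity hP hA hh hβ j 0) hcoe
    have h3 : Tendsto (fun t : ℝ≥0 => Real.exp (-β * t) * (∑' i, ν i * P t i j)) atTop (𝓝 0) := by
      have h4 : Tendsto (fun t : ℝ≥0 => Real.exp (-β * t)) atTop (𝓝 0) :=
        Real.tendsto_exp_atBot.comp (hcoe.const_mul_atTop_of_neg (by linarith))
      refine squeeze_zero_norm (fun t => ?_) h4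
      have := abs_tsum_mul_le (f := fun i => P t i j) hν.distribution.hasSum_one.summable
        fun i => (hP.stochastic t i).abs_le_one j
      simp only [fun i => abs_of_nonneg (hν.distribution.nonneg i),
        hν.distribution.hasSum_one.tsum_eq, one_mul] at this
      rw [norm_mul, Real.norm_eq_abs, Real.abs_exp]
      exact mul_le_of_le_one_right (Real.exp_pos _).le this
    have h5 := h3.add h2
    rw [zero_add] at h5
    refine tendsto_nhds_unique (tendsto_const_nhds.congr h1) h5
  · rintro rfl
    have hdist : IsDistribution (resetStationary P h β) :=
      { nonneg := fun j => integral_nonneg fun s => ageDensity_nonneg hP hh hβ j s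
        hasSum_one := by
          have h1 := hasSum_setIntegral_ageDensity hP hA hh hβ (B := Ioi 0)
            ((exp_neg_integrableOn_Ioi 0 hβ).const_mul β)
          rw [integral_const_mul, integral_exp_mul_Ioi (by linarith)] at h1
          have e : β * (-Real.exp (-β * 0) / -β) = 1 := by
            simp; field_simp
          rwa [e] at h1 }
    refine ⟨hdist, fun t j => ?_⟩
    have hk := key hdist t j
    have hmp := measurePreserving_add_right (volume : Measure ℝ) (t : ℝ)
    have hpre : (fun u : ℝ => u + (t : ℝ)) ⁻¹' Ioi (t : ℝ) = Ioi 0 := by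
      ext u; simp
    have hint : IntegrableOn (fun s => ageDensity P h β j (s + t)) (Ioi 0) := by
      have := (hmp.integrableOn_comp_preimage (measurableEmbedding_addRight (t : ℝ))).2
        (integrableOn_ageDensity hP hA hh hβ j t)
      rwa [hpre] at this
    have h1 := (hasSum_setIntegral_ageDensity_mul hP hA hh hβ t j measurableSet_Ioi
      (fun u hu => (le_of_lt hu)) hint).tsum_eq
    have h2 : ∫ s in Ioi (0 : ℝ), ageDensity P h β j (s + t)
        = ∫ s in Ioi (t : ℝ), ageDensity P h β j s := by
      have := hmp.setIntegral_preimage_emb (measurableEmbedding_addRight (t : ℝ))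
        (ageDensity P h β j) (Ioi (t : ℝ))
      rwa [hpre] at this
    have h3 := intervalIntegral.integral_interval_add_Ioi
      (integrableOn_ageDensity hP hA hh hβ j 0) (integrableOn_ageDensity hP hA hh hβ j t)
    have e : Real.exp (-β * t) * (∑' i, resetStationary P h β i * P t i j)
        + ∫ s in (0 : ℝ)..t, ageDensity P h β j s = resetStationary P h β j := by
      simp only [resetStationary]
      rw [h1, h2, ← h3, ← mul_assoc, ← Real.exp_add, show -β * (t : ℝ) + β * t = 0 by ring,
        Real.exp_zero]
      ring
    rwa [e] at hk

end Reset

end OrderBook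

/-! ### Formal binomial series and their evaluation -/

namespace OrderBook

open Filter Set Finset PowerSeries

theorem factorial_mul_choose (s : ℝ) (n : ℕ) :
    (n.factorial : ℝ) * Ring.choose s n = ∏ a ∈ range n, (s - a) := by
  have h := Ring.descPochhammer_eq_factorial_smul_choose s n
  rw [nsmul_eq_mul] at h
  rw [← h]
  clear h
  induction n with
  | zero => simp
  | succ n ih =>
    rw [descPochhammer_succ_right, Polynomial.smeval_mul, ih, prod_range_succ,
      Polynomial.smeval_sub, Polynomial.smeval_X, Polynomial.smeval_natCast]
    simp

theorem succ_mul_choose_succ (s : ℝ) (n : ℕ) :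
    ((n : ℝ) + 1) * Ring.choose s (n + 1) = s * Ring.choose (s - 1) n := by
  have hn : (n.factorial : ℝ) ≠ 0 := by positivity
  have h1 := factorial_mul_choose s (n + 1)
  have h2 := factorial_mul_choose (s - 1) n
  rw [prod_range_succ', Nat.cast_zero, sub_zero] at h1
  have h3 : ∏ a ∈ range n, (s - ((a + 1 : ℕ) : ℝ)) = ∏ a ∈ range n, (s - 1 - a) :=
    prod_congr rfl fun a _ => by push_cast; ring
  rw [h3, ← h2, Nat.factorial_succ] at h1
  push_cast at h1
  apply mul_left_cancel₀ hn
  linarith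

/-- The formal power series `(1 - c X) ^ s`. -/
def binomPow (s c : ℝ) : ℝ⟦X⟧ := rescale (-c) (binomialSeries ℝ s)

theorem coeff_binomPow (s c : ℝ) (n : ℕ) :
    coeff n (binomPow s c) = (-c) ^ n * Ring.choose s n := by
  simp [binomPow, coeff_rescale]

theorem coeff_binomPow_neg (s c : ℝ) (n : ℕ) :
    coeff n (binomPow (-s) c) = c ^ n * Ring.multichoose s n := by
  rw [coeff_binomPow, Ring.choose_neg', Units.smul_def, neg_pow, Int.coe_negOnePow_natCast,
    zsmul_eq_mul]
  push_cast
  have : ((-1 : ℝ) ^ n * (-1) ^ n) = 1 := by rw [← mul_pow]; simp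
  linear_combination (c ^ n * Ring.multichoose s n) * this

theorem binomPow_add (s t c : ℝ) : binomPow (s + t) c = binomPow s c * binomPow t c := by
  simp [binomPow]

theorem binomPow_zero (c : ℝ) : binomPow 0 c = 1 := by simp [binomPow]

theorem binomPow_zero_right (s : ℝ) : binomPow s 0 = 1 := by
  ext n
  rw [coeff_binomPow, coeff_one]
  rcases n with _ | n <;> simp

theorem binomPow_one (c : ℝ) : binomPow 1 c = 1 - C c * X := by
  have := binomialSeries_nat (R := ℝ) (A := ℝ) 1
  rw [Nat.cast_one, pow_one] at this
  rw [binomPow, this, map_add, map_one, rescale_X, map_neg]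
  ring

theorem binomPow_sub_one (s c : ℝ) : binomPow s c = binomPow (s - 1) c * (1 - C c * X) := by
  rw [← binomPow_one, ← binomPow_add, sub_add_cancel]

theorem derivative_binomPow (s c : ℝ) :
    d⁄dX ℝ (binomPow s c) = C (-c * s) * binomPow (s - 1) c := by
  ext n
  rw [coeff_derivative, coeff_C_mul, coeff_binomPow, coeff_binomPow, pow_succ]
  linear_combination (-c) ^ n * (-c) * succ_mul_choose_succ s n

/-- With opposite exponents the terms linear in X cancel and only the constant r(c - ρ) remains.
This gives both the positivity of the arrival coefficients and their explicit form. -/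
theorem derivative_binomPow_mul_binomPow (r ρ c : ℝ) :
    d⁄dX ℝ (binomPow r ρ * binomPow (-r) c)
      = C (r * (c - ρ)) * (binomPow (r - 1) ρ * binomPow (-r - 1) c) := by
  rw [Derivation.leibniz, smul_eq_mul, smul_eq_mul, derivative_binomPow, derivative_binomPow,
    binomPow_sub_one r ρ, binomPow_sub_one (-r) c]
  simp only [map_mul, map_sub, map_neg]
  ring

/-- The power series `f` converges at `z` to `v`. -/
def HasEval (f : ℝ⟦X⟧) (z v : ℝ) : Prop := HasSum (fun n => coeff n f * z ^ n) v

namespace HasEval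

variable {f g : ℝ⟦X⟧} {z v w : ℝ}

theorem mul (hf : HasEval f z v) (hg : HasEval g z w) : HasEval (f * g) z (v * w) := by
  have hf' := hf.summable.norm
  have hg' := hg.summable.norm
  have e : ∀ n, coeff n (f * g) * z ^ n
      = ∑ kl ∈ antidiagonal n, (coeff kl.1 f * z ^ kl.1) * (coeff kl.2 g * z ^ kl.2) := by
    intro n
    rw [coeff_mul, sum_mul]
    refine sum_congr rfl fun kl hkl => ?_
    rw [← mem_antidiagonal.1 hkl, pow_add]; ring
  have h1 := (summable_norm_sum_mul_antidiagonal_of_summable_norm hf' hg').of_norm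
  have h2 := tsum_mul_tsum_eq_tsum_sum_antidiagonal_of_summable_norm hf' hg'
  rw [hf.tsum_eq, hg.tsum_eq] at h2
  rw [HasEval, h2]
  exact h1.hasSum.of_forall_eq fun n => (e n).symm

theorem const (a : ℝ) : HasEval (C a) z a := by
  have : HasSum (fun n => coeff n (C a : ℝ⟦X⟧) * z ^ n) (coeff 0 (C a : ℝ⟦X⟧) * z ^ 0) :=
    hasSum_single 0 fun n hn => by simp [coeff_C, hn]
  simpa [HasEval] using this

theorem linear (a b : ℝ) : HasEval (C a + C b * X) z (a + b * z) := by
  have : HasSum (fun n => coeff n (C a + C b * X : ℝ⟦X⟧) * z ^ n)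
      (∑ n ∈ range 2, coeff n (C a + C b * X : ℝ⟦X⟧) * z ^ n) := by
    refine hasSum_sum_of_ne_finset_zero fun n hn => ?_
    have : 2 ≤ n := by simpa [Nat.succ_le_iff] using hn
    rw [map_add, coeff_C, coeff_C_mul, coeff_X, if_neg (by omega), if_neg (by omega)]
    simp
  rw [sum_range_succ, sum_range_one] at this
  simpa [HasEval, coeff_X, coeff_C] using! this

theorem pow (hf : HasEval f z v) (n : ℕ) : HasEval (f ^ n) z (v ^ n) := by
  induction n with
  | zero => simpa using HasEval.const (z := z) 1
  | succ n ih => rw [pow_succ, pow_succ]; exact ih.mul hf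

theorem binomPow {s c : ℝ} (hc : |c * z| < 1) :
    HasEval (binomPow s c) z ((1 - c * z) ^ s) := by
  have h := (Real.one_add_rpow_hasFPowerSeriesOnBall_zero (a := s)).hasSum (y := -(c * z))
    (by rw [Metric.mem_eball, edist_zero_right, enorm_neg, ← ofReal_norm,
          ENNReal.ofReal_lt_one]; exact hc)
  rw [zero_add, ← sub_eq_add_neg] at h
  refine h.of_forall_eq fun n => ?_
  rw [coeff_binomPow, binomialSeries_apply, List.ofFn_const, List.prod_replicate, smul_eq_mul,
    ← neg_mul, mul_pow]
  ring

end HasEval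

/-- Uniqueness of the power series of a function at 0. -/
theorem eq_of_hasSum_mul_pow {f g : ℕ → ℝ} {v : ℝ → ℝ}
    (hf : ∀ z, |z| < 1 → HasSum (fun n => f n * z ^ n) (v z))
    (hg : ∀ z, |z| < 1 → HasSum (fun n => g n * z ^ n) (v z)) : f = g := by
  have key : ∀ {f : ℕ → ℝ}, (∀ z, |z| < 1 → HasSum (fun n => f n * z ^ n) (v z)) →
      HasFPowerSeriesAt v (FormalMultilinearSeries.ofScalars ℝ f) 0 := by
    intro f hf
    rw [hasFPowerSeriesAt_iff]
    filter_upwards [Metric.ball_mem_nhds (0 : ℝ) one_pos] with z hz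
    rw [zero_add]
    refine (hf z (by simpa using hz)).of_forall_eq fun n => ?_
    rw [FormalMultilinearSeries.coeff_ofScalars, smul_eq_mul, mul_comm]
  exact FormalMultilinearSeries.ofScalars_series_injective ℝ ℝ
    ((key hf).eq_formalMultilinearSeries (key hg))

theorem coeff_mul_nonneg {f g : ℝ⟦X⟧} (hf : ∀ n, 0 ≤ coeff n f) (hg : ∀ n, 0 ≤ coeff n g) (n : ℕ) :
    0 ≤ coeff n (f * g) := by
  rw [coeff_mul]
  exact sum_nonneg fun _ _ => mul_nonneg (hf _) (hg _)

/-- The equation f' = g f expresses (n+1) f_{n+1} as a sum of products g_k f_l with l ≤ n. -/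
theorem coeff_nonneg_of_derivative {f g : ℝ⟦X⟧} (h0 : 0 ≤ coeff 0 f) (hg : ∀ n, 0 ≤ coeff n g)
    (h : d⁄dX ℝ f = g * f) (n : ℕ) : 0 ≤ coeff n f := by
  induction n using Nat.strong_induction_on with
  | _ n ih =>
    rcases n with _ | n
    · exact h0
    · have h1 := congrArg (coeff n) h
      rw [coeff_derivative, coeff_mul] at h1
      have h2 : 0 ≤ coeff (n + 1) f * ((n : ℝ) + 1) := by
        rw [h1]
        refine sum_nonneg fun kl hkl => mul_nonneg (hg _) (ih _ ?_)
        have := mem_antidiagonal.1 hkl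
        omega
      exact nonneg_of_mul_nonneg_left h2 (by positivity)

/-- Generating function `((1 - c + c x - c x z) / (1 - c z)) ^ r` of the number of shares that
arrived before time `t` and are still present at time `t`, where `x = e^{-θ t}`. -/
def arrivalSeries (r c x : ℝ) : ℝ⟦X⟧ :=
  C ((1 - c + c * x) ^ r) * (binomPow r (c * x / (1 - c + c * x)) * binomPow (-r) c)

/-- Generating function of the queue length started from `i`. -/
def kernelSeries (r c x : ℝ) (i : ℕ) : ℝ⟦X⟧ := (C (1 - x) + C x * X) ^ i * arrivalSeries r c x

/-- Transition kernel of the queue, in the variable `x = e^{-θ t}`. -/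
def kernel (r c x : ℝ) (i j : ℕ) : ℝ := coeff j (kernelSeries r c x i)

/-! ### The kernel: positivity, total mass and semigroup property -/

section Kernel

variable {r c x y : ℝ}

theorem survival_pos (hc1 : c < 1) (hc0 : 0 < c) (hx0 : 0 ≤ x) : 0 < 1 - c + c * x := by
  have := mul_nonneg hc0.le hx0
  linarith

theorem sub_ratio (hc0 : 0 < c) (hc1 : c < 1) (hx0 : 0 ≤ x) :
    c - c * x / (1 - c + c * x) = c * (1 - c) * (1 - x) / (1 - c + c * x) := by
  have := (survival_pos hc1 hc0 hx0).ne'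
  field_simp
  ring

theorem ratio_le (hc0 : 0 < c) (hc1 : c < 1) (hx0 : 0 ≤ x) (hx1 : x ≤ 1) :
    c * x / (1 - c + c * x) ≤ c := by
  have h := sub_ratio hc0 hc1 hx0
  have : 0 ≤ c * (1 - c) * (1 - x) / (1 - c + c * x) :=
    div_nonneg (mul_nonneg (mul_nonneg hc0.le (by linarith)) (by linarith))
      (survival_pos hc1 hc0 hx0).le
  linarith

theorem ratio_nonneg (hc0 : 0 < c) (hc1 : c < 1) (hx0 : 0 ≤ x) :
    0 ≤ c * x / (1 - c + c * x) :=
  div_nonneg (mul_nonneg hc0.le hx0) (survival_pos hc1 hc0 hx0).le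

theorem coeff_zero_arrivalSeries : coeff 0 (arrivalSeries r c x) = (1 - c + c * x) ^ r := by
  simp [arrivalSeries, coeff_mul, coeff_binomPow]

theorem coeff_succ_arrivalSeries (m : ℕ) :
    coeff (m + 1) (arrivalSeries r c x) = (1 - c + c * x) ^ r *
      (r * (c - c * x / (1 - c + c * x)) / (m + 1)) *
      coeff m (binomPow (r - 1) (c * x / (1 - c + c * x)) * binomPow (-r - 1) c) := by
  have h := congrArg (coeff m) (derivative_binomPow_mul_binomPow r (c * x / (1 - c + c * x)) c)
  rw [coeff_derivative, coeff_C_mul] at h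
  rw [arrivalSeries, coeff_C_mul]
  have hm : (m : ℝ) + 1 ≠ 0 := by positivity
  rw [eq_div_of_mul_eq hm h]
  ring

/-- The factor (1 - ρX)^r has coefficients of both signs when ρ > 0, but the logarithmic derivative
r(c - ρ)/((1 - ρX)(1 - cX)) of the product has nonnegative ones because ρ ≤ c. -/
theorem coeff_arrivalSeries_nonneg (hr : 0 < r) (hc0 : 0 < c) (hc1 : c < 1) (hx0 : 0 ≤ x)
    (hx1 : x ≤ 1) (n : ℕ) : 0 ≤ coeff n (arrivalSeries r c x) := by
  have ha := survival_pos hc1 hc0 hx0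
  rw [arrivalSeries, coeff_C_mul]
  refine mul_nonneg (Real.rpow_nonneg ha.le _) ?_
  have hgeom : ∀ {ρ : ℝ}, 0 ≤ ρ → ∀ n, 0 ≤ coeff n (binomPow (-1) ρ) := fun h n => by
    rw [coeff_binomPow_neg, Ring.multichoose_one, mul_one]; positivity
  refine coeff_nonneg_of_derivative (by simp [coeff_mul, coeff_binomPow])
    (g := C (r * (c - c * x / (1 - c + c * x))) *
      (binomPow (-1) (c * x / (1 - c + c * x)) * binomPow (-1) c)) (fun n => ?_) ?_ n
  · rw [coeff_C_mul]
    exact mul_nonneg (mul_nonneg hr.le (sub_nonneg.2 (ratio_le hc0 hc1 hx0 hx1)))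
      (coeff_mul_nonneg (hgeom (ratio_nonneg hc0 hc1 hx0)) (hgeom hc0.le) n)
  · rw [derivative_binomPow_mul_binomPow, sub_eq_add_neg r, sub_eq_add_neg (-r), binomPow_add,
      binomPow_add]
    ring

theorem coeff_binomial_pow (x : ℝ) (i k : ℕ) :
    coeff k ((C (1 - x) + C x * X : ℝ⟦X⟧) ^ i) = i.choose k * x ^ k * (1 - x) ^ (i - k) := by
  have e : (C (1 - x) + C x * X : ℝ⟦X⟧) ^ i
      = (((Polynomial.C x * Polynomial.X + Polynomial.C (1 - x) : Polynomial ℝ) ^ i :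
        Polynomial ℝ) : ℝ⟦X⟧) := by
    rw [Polynomial.coe_pow, Polynomial.coe_add, Polynomial.coe_mul, Polynomial.coe_C,
      Polynomial.coe_C, Polynomial.coe_X, add_comm]
  rw [e, Polynomial.coeff_coe, add_pow, Polynomial.finsetSum_coeff]
  simp only [mul_pow, ← Polynomial.C_pow, ← Polynomial.C_eq_natCast]
  have : ∀ m, (Polynomial.C (x ^ m) * Polynomial.X ^ m * Polynomial.C ((1 - x) ^ (i - m))
      * Polynomial.C ((i.choose m : ℕ) : ℝ) : Polynomial ℝ).coeff k
      = if k = m then i.choose k * x ^ k * (1 - x) ^ (i - k) else 0 := by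
    intro m
    rw [Polynomial.coeff_mul_C, Polynomial.coeff_mul_C, Polynomial.coeff_C_mul_X_pow]
    split_ifs with h
    · subst h; ring
    · simp
  rw [sum_congr rfl fun m _ => this m, sum_ite_eq]
  split_ifs with h
  · rfl
  · rw [Nat.choose_eq_zero_of_lt (by simpa using h)]; simp

theorem kernel_nonneg (hr : 0 < r) (hc0 : 0 < c) (hc1 : c < 1) (hx0 : 0 ≤ x) (hx1 : x ≤ 1)
    (i j : ℕ) : 0 ≤ kernel r c x i j := by
  refine coeff_mul_nonneg (fun n => ?_) (coeff_arrivalSeries_nonneg hr hc0 hc1 hx0 hx1) j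
  rw [coeff_binomial_pow]
  have : 0 ≤ 1 - x := by linarith
  positivity

/-- Since ρ ≤ c < 1, the series converges beyond the unit disc; z = 1 is admissible and yields the
total mass. -/
theorem hasEval_kernelSeries (hc0 : 0 < c) (hc1 : c < 1) (hx0 : 0 ≤ x) (hx1 : x ≤ 1) (i : ℕ)
    {z : ℝ} (hz : |z| ≤ 1) : HasEval (kernelSeries r c x i) z
      ((1 - x + x * z) ^ i * ((1 - c + c * x - c * x * z) / (1 - c * z)) ^ r) := by
  have ha := survival_pos hc1 hc0 hx0
  have hcz : |c * z| < 1 := by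
    rw [abs_mul, abs_of_pos hc0]
    exact (mul_le_of_le_one_right hc0.le hz).trans_lt hc1
  have hρz : |c * x / (1 - c + c * x) * z| < 1 := by
    rw [abs_mul, abs_of_nonneg (ratio_nonneg hc0 hc1 hx0)]
    exact ((mul_le_of_le_one_right (ratio_nonneg hc0 hc1 hx0) hz).trans
      (ratio_le hc0 hc1 hx0 hx1)).trans_lt hc1
  have h1 : 0 < 1 - c * z := by have := (abs_lt.1 hcz).2; linarith
  have h2 : 0 < 1 - c * x / (1 - c + c * x) * z := by have := (abs_lt.1 hρz).2; linarith
  have := ((HasEval.linear (z := z) (1 - x) x).pow i).mul ((HasEval.const ((1 - c + c * x) ^ r)).mul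
    ((HasEval.binomPow (s := r) hρz).mul (HasEval.binomPow (s := -r) hcz)))
  rw [Real.rpow_neg h1.le, ← mul_assoc ((1 - c + c * x) ^ r), ← Real.mul_rpow ha.le h2.le,
    ← div_eq_mul_inv, ← Real.div_rpow (mul_pos ha h2).le h1.le] at this
  convert! this using 4
  field_simp

theorem isDistribution_kernel (hr : 0 < r) (hc0 : 0 < c) (hc1 : c < 1) (hx0 : 0 ≤ x) (hx1 : x ≤ 1)
    (i : ℕ) : IsDistribution (kernel r c x i) where
  nonneg := kernel_nonneg hr hc0 hc1 hx0 hx1 i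
  hasSum_one := by
    have := hasEval_kernelSeries (r := r) hc0 hc1 hx0 hx1 i (z := 1) (by simp)
    have e : (1 - c + c * x - c * x * 1) / (1 - c * 1) = 1 := by
      rw [mul_one, mul_one, add_sub_cancel_right, div_self (by linarith)]
    rw [e] at this
    simpa [HasEval, kernel] using! this

/-- Generating functions in j are compared. Summing over k evaluates the x-series at w = 1 - y + yz.
The affine maps compose with parameter xy, and the denominator 1 - cw of the x-factor cancels the
numerator of the y-factor. -/
theorem hasSum_kernel_mul_kernel (hr : 0 < r) (hc0 : 0 < c) (hc1 : c < 1) (hx0 : 0 ≤ x)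
    (hx1 : x ≤ 1) (hy0 : 0 ≤ y) (hy1 : y ≤ 1) (i j : ℕ) :
    HasSum (fun k => kernel r c x i k * kernel r c y k j) (kernel r c (x * y) i j) := by
  have hd := isDistribution_kernel hr hc0 hc1 hx0 hx1 i
  have hsum : Summable fun k => kernel r c x i k * kernel r c y k j :=
    summable_mul_of_abs_le hd.hasSum_one.summable
      fun k => (isDistribution_kernel hr hc0 hc1 hy0 hy1 k).abs_le_one j
  suffices H : (fun j => ∑' k, kernel r c x i k * kernel r c y k j) = kernel r c (x * y) i by
    rw [← H]; exact hsum.hasSum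
  refine eq_of_hasSum_mul_pow (v := fun z => (1 - x * y + x * y * z) ^ i *
    ((1 - c + c * (x * y) - c * (x * y) * z) / (1 - c * z)) ^ r) (fun z hz => ?_) fun z hz =>
    hasEval_kernelSeries hc0 hc1 (mul_nonneg hx0 hy0) (mul_le_one₀ hx1 hy0 hy1) i hz.le
  have h1 := hasSum_mixture (g := fun j => z ^ j) (B := 1) hd
    (isDistribution_kernel hr hc0 hc1 hy0 hy1)
    (fun k => by rw [abs_pow]; exact pow_le_one₀ (abs_nonneg _) hz.le)
  have hz' := abs_lt.1 hz
  have hw : |1 - y + y * z| ≤ 1 := by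
    rw [abs_le]; constructor <;> nlinarith
  have h2 : ∀ k, ∑' j, kernel r c y k j * z ^ j = (1 - y + y * z) ^ k *
      ((1 - c + c * y - c * y * z) / (1 - c * z)) ^ r := fun k =>
    (hasEval_kernelSeries hc0 hc1 hy0 hy1 k hz.le).tsum_eq
  have h3 := (hasEval_kernelSeries (r := r) hc0 hc1 hx0 hx1 i hw).mul_right
    (((1 - c + c * y - c * y * z) / (1 - c * z)) ^ r)
  have h4 : ∑' k, kernel r c x i k * ∑' j, kernel r c y k j * z ^ j
      = (1 - x * y + x * y * z) ^ i *
        ((1 - c + c * (x * y) - c * (x * y) * z) / (1 - c * z)) ^ r := by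
    have hcz : 0 < 1 - c * z := by nlinarith
    have hcw : 0 < 1 - c * (1 - y + y * z) := by nlinarith [(abs_le.1 hw).2]
    have hxw : 0 < 1 - c + c * x - c * x * (1 - y + y * z) := by
      have := mul_nonneg (mul_nonneg hc0.le hx0) (sub_nonneg.2 (abs_le.1 hw).2)
      linarith
    have e1 : 1 - c + c * y - c * y * z = 1 - c * (1 - y + y * z) := by ring
    have e2 : 1 - c + c * x - c * x * (1 - y + y * z)
        = 1 - c + c * (x * y) - c * (x * y) * z := by ring
    simp only [h2]
    refine (h3.of_forall_eq fun k => ?_).tsum_eq.trans ?_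
    · rw [kernel]; ring
    · rw [mul_assoc, ← Real.mul_rpow (div_pos hxw hcw).le (by rw [e1]; exact (div_pos hcw hcz).le),
        e1, ← e2, div_mul_div_cancel₀ hcw.ne']
      · ring
  rw [h4] at h1
  exact h1

theorem kernel_zero (i j : ℕ) :
    kernel r c 0 i j = (1 - c) ^ r * (c ^ j * Ring.multichoose r j) := by
  rw [kernel, kernelSeries, arrivalSeries]
  simp only [mul_zero, add_zero, zero_div, binomPow_zero_right, sub_zero, map_zero, map_one,
    zero_mul, one_pow, one_mul, coeff_C_mul, coeff_binomPow_neg]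

end Kernel

end OrderBook

/-! ### Relabelling of states; stationary laws from convergence -/

namespace OrderBook

open Filter Set Finset PowerSeries

theorem IsConservative.comap {S T : Type} {Q : T → T → ℝ} (hQ : IsConservative Q) (e : S ≃ T) :
    IsConservative fun i j => Q (e i) (e j) where
  nonneg _ _ hij := hQ.nonneg _ _ (e.injective.ne hij)
  hasSum_zero i := e.hasSum_iff.2 (hQ.hasSum_zero (e i))

theorem IsLyapunov.comap {S T : Type} {Q : T → T → ℝ} {V : T → ℝ} {c : ℝ} (hV : IsLyapunov Q V c)
    (e : S ≃ T) : IsLyapunov (fun i j => Q (e i) (e j)) (fun i => V (e i)) c where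
  pos i := hV.pos (e i)
  finite B := (hV.finite B).preimage e.injective.injOn
  summable i := e.summable_iff.2 (hV.summable (e i))
  le i := by
    rw [e.tsum_eq fun k => Q (e i) k * V k]
    exact hV.le (e i)

theorem IsDistribution.comap {S T : Type} {p : T → ℝ} (hp : IsDistribution p) (e : S ≃ T) :
    IsDistribution fun i => p (e i) :=
  ⟨fun _ => hp.nonneg _, e.hasSum_iff.2 hp.hasSum_one⟩

theorem IsTransitionFunction.comap {S T : Type} [DecidableEq S] [DecidableEq T] {Q : T → T → ℝ}
    {P : ℝ≥0 → T → T → ℝ} (hP : IsTransitionFunction Q P) (e : S ≃ T) :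
    IsTransitionFunction (fun i j => Q (e i) (e j)) (fun t i j => P t (e i) (e j)) where
  stochastic t i := (hP.stochastic t (e i)).comap e
  zero i j := by simp [hP.zero]
  chapman_kolmogorov s t i j := e.hasSum_iff.2 (hP.chapman_kolmogorov s t (e i) (e j))
  generator i j := hP.generator (e i) (e j)

theorem IsStationary.comap {S T : Type} {P : ℝ≥0 → T → T → ℝ} {ν : T → ℝ} (hν : IsStationary P ν)
    (e : S ≃ T) : IsStationary (fun t i j => P t (e i) (e j)) (fun i => ν (e i)) :=
  ⟨hν.distribution.comap e, fun t j => e.hasSum_iff.2 (hν.invariant t (e j))⟩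

/-- Dominated convergence in the invariance relation, with the weights ν i as bound, identifies ν j
with π j. -/
theorem isStationary_iff_of_tendsto {S : Type} [DecidableEq S] {Q : S → S → ℝ}
    {P : ℝ≥0 → S → S → ℝ} {π : S → ℝ} (hP : IsTransitionFunction Q P) (hπ : IsStationary P π)
    (hlim : ∀ i j, Tendsto (fun t => P t i j) atTop (𝓝 (π j))) (ν : S → ℝ) :
    IsStationary P ν ↔ ν = π := by
  refine ⟨fun hν => funext fun j => ?_, fun h => h ▸ hπ⟩
  have h1 : Tendsto (fun t => ∑' i, ν i * P t i j) atTop (𝓝 (∑' i, ν i * π j)) := by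
    refine tendsto_tsum_of_dominated_convergence hν.distribution.hasSum_one.summable
      (fun i => (hlim i j).const_mul _) (Eventually.of_forall fun t i => ?_)
    rw [Real.norm_eq_abs, abs_mul, abs_of_nonneg (hν.distribution.nonneg i)]
    exact mul_le_of_le_one_right (hν.distribution.nonneg i) ((hP.stochastic t i).abs_le_one j)
  simp only [fun t => (hν.invariant t j).tsum_eq, tsum_mul_right,
    hν.distribution.hasSum_one.tsum_eq, one_mul] at h1
  exact tendsto_nhds_unique tendsto_const_nhds h1

/-! ### The generator of the queue: conservativity and non-explosion -/

section Generator

variable {lam theta q : ℝ}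

theorem hasSum_queueGenerator_mul {V : ℕ → ℝ} {i : ℕ} {s : ℝ}
    (hs : HasSum (fun n => q * (1 - q) ^ n * V (i + 1 + n)) s) :
    HasSum (fun j => queueGenerator lam 0 theta (geometricSize q) i j * V j)
      (lam * s - (lam + i * theta) * V i + i * theta * V (i - 1)) := by
  have hinj : Function.Injective fun n : ℕ => i + 1 + n := fun a b h => by simpa using h
  have h1 : HasSum (fun j => if i < j then lam * geometricSize q (j - i) * V j else 0)
      (lam * s) := by
    refine (hinj.hasSum_iff fun j hj => ?_).1 ?_
    · rw [if_neg fun h => hj ⟨j - i - 1, by simp only; omega⟩]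
    · refine (hs.mul_left lam).of_forall_eq fun n => ?_
      have e : i + 1 + n - i = n + 1 := by omega
      simp only [Function.comp_apply]
      rw [if_pos (by omega), e, geometricSize, if_neg (by omega), Nat.add_sub_cancel]
      ring
  have h2 := hasSum_ite_eq i (-(lam + i * theta) * V i)
  -- For i = 0 the truncated i - 1 is 0 again, harmless because the weight i * theta vanishes.
  have h3 := hasSum_ite_eq (i - 1) (i * theta * V (i - 1))
  have h := (h1.add h2).add h3
  rw [neg_mul, ← sub_eq_add_neg] at h
  refine h.of_forall_eq fun j => ?_
  unfold queueGenerator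
  rcases lt_trichotomy i j with hij | rfl | hij
  · have : j ≠ i - 1 := by omega
    simp [hij, hij.ne', this]
  · rcases i with _ | i
    · simp
    · simp; ring
  · by_cases hj : i = j + 1
    · subst hj
      simp
    · have : j ≠ i - 1 := by omega
      simp [hij.not_gt, hij.ne, hij.ne', hj, this]

theorem isConservative_queueGenerator (hlam : 0 ≤ lam) (htheta : 0 ≤ theta) (hq : 0 < q)
    (hq' : q < 1) : IsConservative (queueGenerator lam 0 theta (geometricSize q)) where
  nonneg i j hij := by
    have : 0 ≤ 1 - q := by linarith
    unfold queueGenerator geometricSize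
    split_ifs <;> positivity
  hasSum_zero i := by
    have h1 := (hasSum_geometric_of_lt_one (r := 1 - q) (by linarith) (by linarith)).mul_left q
    rw [sub_sub_cancel, mul_inv_cancel₀ hq.ne'] at h1
    have h2 := hasSum_queueGenerator_mul (lam := lam) (theta := theta) (q := q) (V := fun _ => 1)
      (i := i) (s := 1) (by simpa using h1)
    simpa using h2

/-- A batch has mean 1/q, so the generator sends i + 1 to lam/q - iθ, which is at most (lam/q)(i +
1). -/
theorem isLyapunov_queueGenerator (hlam : 0 ≤ lam) (htheta : 0 ≤ theta) (hq : 0 < q)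
    (hq' : q < 1) : IsLyapunov (queueGenerator lam 0 theta (geometricSize q))
      (fun i => (i : ℝ) + 1) (lam / q) := by
  have key : ∀ i : ℕ, HasSum (fun j => queueGenerator lam 0 theta (geometricSize q) i j *
      ((j : ℝ) + 1)) (lam / q - i * theta) := by
    intro i
    have h1 := (hasSum_geometric_of_lt_one (r := 1 - q) (by linarith) (by linarith)).mul_left
      (q * (i + 2))
    have h2 := (hasSum_coe_mul_geometric_of_norm_lt_one (r := 1 - q)
      (by rw [Real.norm_eq_abs, abs_lt]; constructor <;> linarith)).mul_left q
    have h3 := hasSum_queueGenerator_mul (lam := lam) (theta := theta)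
      (V := fun j => (j : ℝ) + 1) (i := i) ((h1.add h2).of_forall_eq fun n => by push_cast; ring)
    convert! h3 using 1
    rw [sub_sub_cancel]
    rcases i with _ | i
    · simp; field_simp; ring
    · push_cast [Nat.add_sub_cancel]; field_simp; ring
  refine ⟨fun i => by positivity, fun B => ?_, fun i => (key i).summable, fun i => ?_⟩
  · refine (Set.finite_Iic ⌊B⌋₊).subset fun i hi => ?_
    have : (i : ℝ) + 1 ≤ B := hi
    exact Nat.le_floor (by linarith)
  · rw [(key i).tsum_eq]
    have h1 : 0 ≤ lam / q * i := by positivity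
    have h2 : 0 ≤ i * theta := by positivity
    linarith

end Generator

/-! ### Derivative of the kernel at time zero -/

section Derivative

theorem hasDerivAt_coeff_mul {F G : ℝ → ℝ⟦X⟧} {F' G' : ℝ⟦X⟧} {x : ℝ}
    (hF : ∀ n, HasDerivAt (fun y => coeff n (F y)) (coeff n F') x)
    (hG : ∀ n, HasDerivAt (fun y => coeff n (G y)) (coeff n G') x) (n : ℕ) :
    HasDerivAt (fun y => coeff n (F y * G y)) (coeff n (F' * G x + F x * G')) x := by
  rw [map_add, coeff_mul, coeff_mul, ← sum_add_distrib]
  simp only [coeff_mul]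
  exact HasDerivAt.fun_sum fun kl _ => (hF kl.1).mul (hG kl.2)

theorem hasDerivAt_coeff_pow {F : ℝ → ℝ⟦X⟧} {F' : ℝ⟦X⟧} {x : ℝ}
    (hF : ∀ n, HasDerivAt (fun y => coeff n (F y)) (coeff n F') x) (i n : ℕ) :
    HasDerivAt (fun y => coeff n (F y ^ i)) (coeff n (C (i : ℝ) * F x ^ (i - 1) * F')) x := by
  induction i generalizing n with
  | zero => simpa using hasDerivAt_const x _
  | succ i ih =>
    have h := hasDerivAt_coeff_mul ih hF n
    simp only [pow_succ]
    convert! h using 2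
    rcases i with _ | i
    · simp
    · simp only [Nat.add_sub_cancel]
      push_cast
      simp only [map_add, map_one]
      ring

variable {r c : ℝ}

/-- The derivative of `arrivalSeries r c` at `1`. -/
def arrivalSeriesDeriv (r c : ℝ) : ℝ⟦X⟧ :=
  PowerSeries.mk fun n => if n = 0 then r * c else -(r * c * geometricSize (1 - c) n)

theorem hasDerivAt_survival (c x : ℝ) : HasDerivAt (fun y => 1 - c + c * y) c x := by
  simpa using ((hasDerivAt_id x).const_mul c).const_add (1 - c)

theorem differentiableAt_ratio (hc0 : 0 < c) (hc1 : c < 1) {x : ℝ} (hx : 0 ≤ x) :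
    DifferentiableAt ℝ (fun y => c * y / (1 - c + c * y)) x := by
  have := (survival_pos hc1 hc0 hx).ne'
  fun_prop (disch := assumption)

theorem differentiableAt_coeff_binomPow (s : ℝ) {f : ℝ → ℝ} {x : ℝ} (hf : DifferentiableAt ℝ f x)
    (n : ℕ) : DifferentiableAt ℝ (fun y => coeff n (binomPow s (f y))) x := by
  simp only [coeff_binomPow]
  fun_prop

theorem differentiableAt_coeff_binomPow_mul (s s' : ℝ) (hc0 : 0 < c) (hc1 : c < 1) {x : ℝ}
    (hx : 0 ≤ x) (n : ℕ) : DifferentiableAt ℝ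
      (fun y => coeff n (binomPow s (c * y / (1 - c + c * y)) * binomPow s' c)) x := by
  simp only [coeff_mul]
  exact DifferentiableAt.fun_sum fun kl _ => (differentiableAt_coeff_binomPow s
    (differentiableAt_ratio hc0 hc1 hx) _).mul (differentiableAt_const _)

theorem differentiableAt_survival_rpow (r : ℝ) (hc0 : 0 < c) (hc1 : c < 1) {x : ℝ} (hx : 0 ≤ x) :
    DifferentiableAt ℝ (fun y => (1 - c + c * y) ^ r) x :=
  (hasDerivAt_survival c x).differentiableAt.rpow_const (Or.inl (survival_pos hc1 hc0 hx).ne')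

theorem differentiableAt_coeff_arrivalSeries (r : ℝ) (hc0 : 0 < c) (hc1 : c < 1) {x : ℝ}
    (hx : 0 ≤ x) (n : ℕ) : DifferentiableAt ℝ (fun y => coeff n (arrivalSeries r c y)) x := by
  simp only [arrivalSeries, coeff_C_mul]
  exact (differentiableAt_survival_rpow r hc0 hc1 hx).mul
    (differentiableAt_coeff_binomPow_mul r (-r) hc0 hc1 hx n)

theorem continuousAt_kernel (r : ℝ) (hc0 : 0 < c) (hc1 : c < 1) {x : ℝ} (hx : 0 ≤ x) (i j : ℕ) :
    ContinuousAt (fun y => kernel r c y i j) x := by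
  simp only [kernel, kernelSeries, coeff_mul, coeff_binomial_pow]
  refine (DifferentiableAt.fun_sum (𝕜 := ℝ) fun kl _ => DifferentiableAt.mul (by fun_prop) ?_).continuousAt
  exact differentiableAt_coeff_arrivalSeries r hc0 hc1 hx _

theorem arrivalSeries_one (r c : ℝ) : arrivalSeries r c 1 = 1 := by
  rw [arrivalSeries, mul_one, sub_add_cancel, div_one, ← binomPow_add, add_neg_cancel,
    binomPow_zero, Real.one_rpow, map_one, one_mul]

theorem hasDerivAt_coeff_arrivalSeries (r : ℝ) (hc0 : 0 < c) (hc1 : c < 1) (n : ℕ) :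
    HasDerivAt (fun y => coeff n (arrivalSeries r c y)) (coeff n (arrivalSeriesDeriv r c)) 1 := by
  rw [arrivalSeriesDeriv, coeff_mk]
  rcases n with _ | m
  · simp only [coeff_zero_arrivalSeries]
    have := (hasDerivAt_survival c 1).rpow_const (p := r) (Or.inl (by simp))
    simpa [mul_comm] using this
  · simp only [coeff_succ_arrivalSeries]
    rw [if_neg (by omega)]
    -- The factor c - ρ(y) vanishes at y = 1, so of the remaining factor `v` only its value there
    -- and its differentiability matter.
    set v : ℝ → ℝ := fun y => (1 - c + c * y) ^ r *
      coeff m (binomPow (r - 1) (c * y / (1 - c + c * y)) * binomPow (-r - 1) c) with hv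
    have hvd : DifferentiableAt ℝ v 1 :=
      (differentiableAt_survival_rpow r hc0 hc1 zero_le_one).mul
        (differentiableAt_coeff_binomPow_mul (r - 1) (-r - 1) hc0 hc1 zero_le_one m)
    have hv1 : v 1 = c ^ m * (m + 1) := by
      simp only [hv]
      rw [mul_one, sub_add_cancel, div_one, ← binomPow_add, Real.one_rpow, one_mul,
        show r - 1 + (-r - 1) = -2 by ring, coeff_binomPow_neg, Ring.multichoose_two]
    have hu : HasDerivAt (fun y => r * (c - c * y / (1 - c + c * y)) / (m + 1))
        (r * (-(c * (1 - c))) / (m + 1)) 1 := by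
      have h1 := (((hasDerivAt_id (1 : ℝ)).const_mul c).div (hasDerivAt_survival c 1) (by simp))
      have h2 := ((h1.const_sub c).const_mul r).div_const ((m : ℝ) + 1)
      convert! h2 using 1
      simp
      ring
    have h := hu.mul hvd.hasDerivAt
    rw [hv1] at h
    have hm : (m : ℝ) + 1 ≠ 0 := by positivity
    convert! h using 1
    · funext y; simp only [hv, Pi.mul_apply]; ring
    · simp [geometricSize]; field_simp

theorem hasDerivAt_kernel (theta : ℝ) (hc0 : 0 < c) (hc1 : c < 1) (i j : ℕ) :
    HasDerivAt (fun t : ℝ => kernel r c (Real.exp (-theta * t)) i j)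
      (queueGenerator (r * c * theta) 0 theta (geometricSize (1 - c)) i j) 0 := by
  have hL : ∀ n, HasDerivAt (fun y : ℝ => coeff n (C (1 - y) + C y * X : ℝ⟦X⟧))
      (coeff n (-1 + X : ℝ⟦X⟧)) 1 := by
    intro n
    simp only [map_add, coeff_C_mul, map_neg, coeff_C, coeff_one]
    have h1 := ((hasDerivAt_id (1 : ℝ)).const_sub 1)
    have h2 := (hasDerivAt_id (1 : ℝ)).mul_const (coeff n (X : ℝ⟦X⟧))
    rw [one_mul] at h2
    split_ifs with hn
    · exact h1.add h2
    · simpa using! h2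
  have h := hasDerivAt_coeff_mul (hasDerivAt_coeff_pow hL i)
    (hasDerivAt_coeff_arrivalSeries r hc0 hc1) j
  have he : HasDerivAt (fun t : ℝ => Real.exp (-theta * t)) (-theta) 0 := by
    simpa using ((hasDerivAt_id (0 : ℝ)).const_mul (-theta)).exp
  have h1 : Real.exp (-theta * 0) = 1 := by simp
  rw [← h1] at h
  have hcomp := h.comp (0 : ℝ) he
  rw [h1] at hcomp
  convert! hcomp using 1
  -- At x = 1 the derivative in x is i X^{i-1}(X - 1) plus X^i times the derivative of the arrival
  -- series; multiplied by -θ, its coefficients are row i of the generator.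
  rw [arrivalSeries_one, sub_self, map_zero, zero_add, map_one, one_mul, mul_one, map_add,
    coeff_X_pow_mul', mul_assoc (C (i : ℝ)), coeff_C_mul, coeff_X_pow_mul', arrivalSeriesDeriv, coeff_mk,
    map_add, map_neg, coeff_one, coeff_X]
  unfold queueGenerator
  rcases lt_trichotomy i j with hij | rfl | hij
  · have h1 : ¬ j - i = 0 := by omega
    rw [if_pos hij, if_pos hij.le, if_neg h1]
    rcases i with _ | i
    · simp
      ring
    · have h2 : i + 1 - 1 ≤ j := by omega
      have h3 : ¬ j - (i + 1 - 1) = 0 := by omega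
      have h4 : ¬ j - (i + 1 - 1) = 1 := by omega
      rw [if_pos h2, if_neg h3, if_neg h4]
      ring
  · rcases i with _ | i
    · simp
    · simp
      ring
  · rw [if_neg hij.not_gt, if_neg hij.ne', if_neg hij.not_ge]
    obtain ⟨i, rfl⟩ : ∃ k, i = k + 1 := ⟨i - 1, by omega⟩
    rcases eq_or_ne i j with rfl | hne
    · simp
      ring
    · have h2 : ¬ i + 1 - 1 ≤ j := by omega
      rw [if_neg h2, if_neg (by omega)]
      simp

end Derivative

/-- Transition function of the queue on `ℕ`. -/
def queueTransition (r c theta : ℝ) (t : ℝ≥0) (i j : ℕ) : ℝ :=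
  kernel r c (Real.exp (-theta * t)) i j

/-! ### The queue: transition function, stationary law, convergence -/

section Queue

variable {r c theta : ℝ}

theorem exp_neg_mul_le_one (htheta : 0 < theta) {t : ℝ} (ht : 0 ≤ t) :
    Real.exp (-theta * t) ≤ 1 :=
  Real.exp_le_one_iff.2 (by nlinarith)

theorem isTransitionFunction_queueTransition (hr : 0 < r) (hc0 : 0 < c) (hc1 : c < 1)
    (htheta : 0 < theta) : IsTransitionFunction
      (queueGenerator (r * c * theta) 0 theta (geometricSize (1 - c)))
      (queueTransition r c theta) where
  stochastic t i := isDistribution_kernel hr hc0 hc1 (Real.exp_pos _).le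
    (exp_neg_mul_le_one htheta t.coe_nonneg) i
  zero i j := by
    rw [queueTransition, NNReal.coe_zero, mul_zero, Real.exp_zero, kernel, kernelSeries,
      arrivalSeries_one, sub_self, map_zero, zero_add, map_one, one_mul, mul_one, coeff_X_pow]
    simp [eq_comm]
  chapman_kolmogorov s t i j := by
    have := hasSum_kernel_mul_kernel hr hc0 hc1 (Real.exp_pos (-theta * s)).le
      (exp_neg_mul_le_one htheta s.coe_nonneg) (Real.exp_pos (-theta * t)).le
      (exp_neg_mul_le_one htheta t.coe_nonneg) i j
    rwa [← Real.exp_add, ← mul_add, ← NNReal.coe_add] at this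
  generator i j := by
    simpa [queueTransition] using
      (hasDerivAt_kernel (r := r) theta hc0 hc1 i j).tendsto_div_nhdsGT_zero

/-- The value x = 0 corresponds to infinite time, and 0 · y = 0 turns the semigroup property into
invariance. -/
theorem isStationary_queueTransition (hr : 0 < r) (hc0 : 0 < c) (hc1 : c < 1) (htheta : 0 < theta) :
    IsStationary (queueTransition r c theta) (kernel r c 0 0) where
  distribution := isDistribution_kernel hr hc0 hc1 le_rfl zero_le_one 0
  invariant t j := by
    have := hasSum_kernel_mul_kernel hr hc0 hc1 le_rfl zero_le_one (Real.exp_pos (-theta * t)).le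
      (exp_neg_mul_le_one htheta t.coe_nonneg) 0 j
    rwa [zero_mul] at this

/-- The kernel is continuous at x = 0, where it no longer depends on i. -/
theorem tendsto_queueTransition (hc0 : 0 < c) (hc1 : c < 1) (htheta : 0 < theta) (i j : ℕ) :
    Tendsto (fun t => queueTransition r c theta t i j) atTop (𝓝 (kernel r c 0 0 j)) := by
  have h1 : Tendsto (fun t : ℝ≥0 => Real.exp (-theta * t)) atTop (𝓝 0) :=
    Real.tendsto_exp_atBot.comp
      ((NNReal.tendsto_coe_atTop.2 tendsto_id).const_mul_atTop_of_neg (by linarith))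
  have h2 := (continuousAt_kernel r hc0 hc1 le_rfl i j).tendsto.comp h1
  rw [kernel_zero] at h2 ⊢
  exact h2

end Queue

theorem factorial_mul_multichoose (r : ℝ) (n : ℕ) :
    (n.factorial : ℝ) * Ring.multichoose r n = ∏ b ∈ range n, (r + b) := by
  have h := Ring.factorial_nsmul_multichoose_eq_ascPochhammer r n
  rw [nsmul_eq_mul] at h
  rw [h]
  clear h
  induction n with
  | zero => simp
  | succ n ih =>
    rw [ascPochhammer_succ_right, Polynomial.smeval_mul, ih, prod_range_succ,
      Polynomial.smeval_add, Polynomial.smeval_X, Polynomial.smeval_natCast]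
    simp

theorem prod_range_add_eq_Gamma_div {r : ℝ} (hr : 0 < r) (n : ℕ) :
    ∏ b ∈ range n, (r + b) = Real.Gamma (n + r) / Real.Gamma r := by
  have hG := (Real.Gamma_pos_of_pos hr).ne'
  induction n with
  | zero => simp [hG]
  | succ n ih =>
    rw [prod_range_succ, ih, Nat.cast_succ, add_right_comm, Real.Gamma_add_one (by positivity)]
    ring

theorem kernel_zero_eq_polya {r q : ℝ} (hr : 0 < r) (i n : ℕ) :
    kernel r (1 - q) 0 i n = polya r q n := by
  have hn : (n.factorial : ℝ) ≠ 0 := by positivity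
  rw [kernel_zero, polya, ← prod_range_add_eq_Gamma_div hr, ← factorial_mul_multichoose,
    sub_sub_cancel]
  field_simp

end OrderBook

/-! ### Expansion of the kernel into the products and integrals of the formula -/

namespace OrderBook

open Filter Set Finset PowerSeries MeasureTheory

theorem prod_Icc_one_sub (r c : ℝ) (l : ℕ) :
    ∏ a ∈ Finset.Icc 1 l, (r * c - a * c) = c ^ l * (l.factorial * Ring.choose (r - 1) l) := by
  rw [factorial_mul_choose, ← Finset.Ico_add_one_right_eq_Icc, Finset.prod_Ico_eq_prod_range,
    Nat.add_sub_cancel, show c ^ l = ∏ _a ∈ Finset.range l, c by simp, ← Finset.prod_mul_distrib]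
  refine Finset.prod_congr rfl fun a _ => ?_
  push_cast; ring

theorem prod_Icc_one_add (r c : ℝ) (l : ℕ) :
    ∏ b ∈ Finset.Icc 1 l, (r * c + b * c) = c ^ l * (l.factorial * Ring.multichoose (r + 1) l) := by
  rw [factorial_mul_multichoose, ← Finset.Ico_add_one_right_eq_Icc, Finset.prod_Ico_eq_prod_range,
    Nat.add_sub_cancel, show c ^ l = ∏ _a ∈ Finset.range l, c by simp, ← Finset.prod_mul_distrib]
  refine Finset.prod_congr rfl fun a _ => ?_
  push_cast; ring

/-- The coefficients of (1 - ρX)^{r-1}(1 - cX)^{-r-1} form a convolution whose binomial coefficients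
are the two products. The factor 1 - x comes from c - ρ, and x^l with the lowered exponent r - l - 1
from ρ^l and c - ρ. -/
theorem coeff_succ_arrivalSeries_eq_sum {r c x : ℝ} (hc0 : 0 < c) (hc1 : c < 1) (hx0 : 0 ≤ x)
    (m : ℕ) : coeff (m + 1) (arrivalSeries r c x) =
      (1 - c) * (r * c) * (1 / ((m + 1).factorial : ℝ)) * ∑ l ∈ Finset.range (m + 1),
        ((m.choose l : ℝ) * (-1) ^ l * (∏ a ∈ Finset.Icc 1 l, (r * c - a * c))
          * (∏ b ∈ Finset.Icc 1 (m - l), (r * c + b * c))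
          * ((1 - x) * x ^ l * (1 - c + c * x) ^ (r - l - 1))) := by
  have ha := survival_pos hc1 hc0 hx0
  rw [coeff_succ_arrivalSeries, coeff_mul, Finset.Nat.sum_antidiagonal_eq_sum_range_succ_mk,
    sub_ratio hc0 hc1 hx0, Finset.mul_sum, Finset.mul_sum]
  refine Finset.sum_congr rfl fun l hl => ?_
  have hl : l ≤ m := Nat.lt_succ_iff.1 (Finset.mem_range.1 hl)
  rw [prod_Icc_one_sub, prod_Icc_one_add, coeff_binomPow, ← neg_add', coeff_binomPow_neg,
    Nat.cast_choose ℝ hl, Nat.factorial_succ, Real.rpow_sub ha, Real.rpow_sub ha, Real.rpow_natCast,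
    Real.rpow_one, neg_pow, div_pow, mul_pow]
  have h1 : (m.factorial : ℝ) ≠ 0 := by positivity
  have h2 : (l.factorial : ℝ) ≠ 0 := by positivity
  have h3 : ((m - l).factorial : ℝ) ≠ 0 := by positivity
  have h4 : (m : ℝ) + 1 ≠ 0 := by positivity
  have h5 := ha.ne'
  push_cast
  field_simp

section Integrals

variable {theta beta : ℝ}

/-- A continuous φ is bounded on [0, 1], so e^{-βt} dominates up to a constant. -/
theorem integrableOn_comp_exp_mul_exp {φ : ℝ → ℝ} (htheta : 0 < theta) (hbeta : 0 < beta)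
    (hφ : ContinuousOn φ (Icc 0 1)) :
    IntegrableOn (fun t : ℝ => φ (Real.exp (-theta * t)) * Real.exp (-beta * t)) (Ioi 0) := by
  obtain ⟨B, hB⟩ := isCompact_Icc.exists_bound_of_continuousOn hφ
  have hmem : ∀ t ∈ Ioi (0 : ℝ), Real.exp (-theta * t) ∈ Icc (0 : ℝ) 1 := fun t ht =>
    ⟨(Real.exp_pos _).le, exp_neg_mul_le_one htheta (le_of_lt ht)⟩
  have hcont : ContinuousOn (fun t : ℝ => φ (Real.exp (-theta * t)) * Real.exp (-beta * t))
      (Ioi 0) :=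
    (hφ.comp (by fun_prop) hmem).mul (by fun_prop)
  refine Integrable.mono' ((exp_neg_integrableOn_Ioi 0 hbeta).const_mul B)
    (hcont.aestronglyMeasurable measurableSet_Ioi)
    ((ae_restrict_iff' measurableSet_Ioi).2 (ae_of_all _ fun t ht => ?_))
  rw [norm_mul, Real.norm_of_nonneg (Real.exp_pos (-beta * t)).le]
  exact mul_le_mul_of_nonneg_right (hB _ (hmem t ht)) (Real.exp_pos _).le

theorem integrandArrival_eq (lam theta q beta : ℝ) (i k l : ℕ) (t : ℝ) :
    integrandArrival lam theta q beta i k l t =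
      (1 - Real.exp (-theta * t)) ^ (i - k) * Real.exp (-theta * t) ^ (l + k)
        * (q + (1 - q) * Real.exp (-theta * t)) ^ (lam / (theta * (1 - q)) - l - 1)
        * Real.exp (-beta * t) := by
  rw [integrandArrival, ← Real.exp_nat_mul]
  congr 4
  push_cast; ring

theorem integrandSurvival_eq (lam theta q beta : ℝ) (i : ℕ) {j : ℕ} (hj : 1 ≤ j) (t : ℝ) :
    integrandSurvival lam theta q beta i j t =
      Real.exp (-theta * t) ^ (j - 1) * (1 - Real.exp (-theta * t)) ^ (i - j)
        * (q + (1 - q) * Real.exp (-theta * t)) ^ (lam / (theta * (1 - q)))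
        * Real.exp (-beta * t) := by
  rw [integrandSurvival, ← Real.exp_nat_mul]
  congr 4
  push_cast [hj]; ring

theorem continuousOn_survival_rpow {q : ℝ} (hq : 0 < q) (hq' : q < 1) (s : ℝ) :
    ContinuousOn (fun x : ℝ => (q + (1 - q) * x) ^ s) (Icc 0 1) := by
  refine ContinuousOn.rpow_const (by fun_prop) fun x hx => Or.inl ?_
  have := mul_nonneg (sub_nonneg.2 hq'.le) hx.1
  linarith

theorem integrableOn_integrandArrival (lam : ℝ) {q : ℝ} (htheta : 0 < theta) (hbeta : 0 < beta)
    (hq : 0 < q) (hq' : q < 1) (i k l : ℕ) :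
    IntegrableOn (integrandArrival lam theta q beta i k l) (Ioi 0) := by
  have hφ : ContinuousOn (fun x : ℝ => (1 - x) ^ (i - k) * x ^ (l + k)
      * (q + (1 - q) * x) ^ (lam / (theta * (1 - q)) - l - 1)) (Icc 0 1) :=
    ContinuousOn.mul (by fun_prop) (continuousOn_survival_rpow hq hq' _)
  exact (integrableOn_comp_exp_mul_exp htheta hbeta hφ).congr_fun
    (fun t _ => (integrandArrival_eq lam theta q beta i k l t).symm) measurableSet_Ioi

theorem integrableOn_integrandSurvival (lam : ℝ) {q : ℝ} (htheta : 0 < theta) (hbeta : 0 < beta)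
    (hq : 0 < q) (hq' : q < 1) (i : ℕ) {j : ℕ} (hj : 1 ≤ j) :
    IntegrableOn (integrandSurvival lam theta q beta i j) (Ioi 0) := by
  have hφ : ContinuousOn (fun x : ℝ => x ^ (j - 1) * (1 - x) ^ (i - j)
      * (q + (1 - q) * x) ^ (lam / (theta * (1 - q)))) (Icc 0 1) :=
    ContinuousOn.mul (by fun_prop) (continuousOn_survival_rpow hq hq' _)
  exact (integrableOn_comp_exp_mul_exp htheta hbeta hφ).congr_fun
    (fun t _ => (integrandSurvival_eq lam theta q beta i hj t).symm) measurableSet_Ioi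

end Integrals

/-- The part of the discounted transition probability from `i` to `j` in which some of the shares
present at time `t` arrived after time zero. -/
def arrivalDensity (r c theta beta : ℝ) (i j : ℕ) (t : ℝ) : ℝ :=
  (∑ k ∈ Finset.range (min (i + 1) j), (i.choose k : ℝ) * Real.exp (-theta * t) ^ k
    * (1 - Real.exp (-theta * t)) ^ (i - k)
    * coeff (j - k) (arrivalSeries r c (Real.exp (-theta * t)))) * Real.exp (-beta * t)

section Formula

variable {lam theta q beta : ℝ}

theorem arrivalDensity_nonneg {r c : ℝ} (hr : 0 < r) (hc0 : 0 < c) (hc1 : c < 1)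
    (htheta : 0 < theta) {t : ℝ} (ht : 0 ≤ t) (i j : ℕ) :
    0 ≤ arrivalDensity r c theta beta i j t := by
  have h1 := exp_neg_mul_le_one htheta ht
  refine mul_nonneg (Finset.sum_nonneg fun k _ => ?_) (Real.exp_pos _).le
  have h2 := coeff_arrivalSeries_nonneg hr hc0 hc1 (Real.exp_pos (-theta * t)).le h1 (j - k)
  have h3 : 0 ≤ 1 - Real.exp (-theta * t) := by linarith
  positivity

theorem kernel_mul_exp_eq (i j : ℕ) (t : ℝ) :
    kernel (lam / (theta * (1 - q))) (1 - q) (Real.exp (-theta * t)) i j * Real.exp (-beta * t)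
      = arrivalDensity (lam / (theta * (1 - q))) (1 - q) theta beta i j t
        + (i.choose j : ℝ) * integrandSurvival lam theta q beta (i + 1) (j + 1) t := by
  rw [kernel, kernelSeries, coeff_mul, Finset.Nat.sum_antidiagonal_eq_sum_range_succ_mk,
    Finset.sum_range_succ, arrivalDensity, integrandSurvival_eq _ _ _ _ _ (by omega)]
  simp only [coeff_binomial_pow, Nat.sub_self, coeff_zero_arrivalSeries, Nat.add_sub_cancel,
    Nat.add_sub_add_right, sub_sub_cancel]
  have h1 : ∑ k ∈ Finset.range j, (i.choose k : ℝ) * Real.exp (-theta * t) ^ k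
      * (1 - Real.exp (-theta * t)) ^ (i - k)
      * coeff (j - k) (arrivalSeries (lam / (theta * (1 - q))) (1 - q) (Real.exp (-theta * t)))
      = ∑ k ∈ Finset.range (min (i + 1) j), (i.choose k : ℝ) * Real.exp (-theta * t) ^ k
      * (1 - Real.exp (-theta * t)) ^ (i - k)
      * coeff (j - k) (arrivalSeries (lam / (theta * (1 - q))) (1 - q)
        (Real.exp (-theta * t))) := by
    -- Terms with k > i vanish, since no more than i initial shares can survive. The term k = j, in
    -- which nothing that arrived is left, has been split off as the survival part.
    refine (Finset.sum_subset (Finset.range_mono (min_le_right _ _)) fun k hk hk' => ?_).symm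
    have hik : i < k := by
      simp only [Finset.mem_range] at hk hk'
      omega
    simp [Nat.choose_eq_zero_of_lt hik]
  rw [h1]
  ring

theorem arrivalDensity_eq_sum (hq : 0 < q) (hq' : q < 1) (htheta : 0 < theta) (i j : ℕ) (t : ℝ) :
    arrivalDensity (lam / (theta * (1 - q))) (1 - q) theta beta i j t =
      q * (lam / theta) * ∑ k ∈ Finset.range (min (i + 1) j),
        (i.choose k : ℝ) * (1 / ((j - k).factorial : ℝ)) *
          ∑ l ∈ Finset.range (j - k),
            ((j + 1 - 2 - k).choose l : ℝ) * (-1) ^ l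
              * (∏ a ∈ Finset.Icc 1 l, (lam / theta - a * (1 - q)))
              * (∏ b ∈ Finset.Icc 1 (j + 1 - 2 - k - l), (lam / theta + b * (1 - q)))
              * integrandArrival lam theta q beta (i + 1) k l t := by
  have hq0 : (1 - q) ≠ 0 := by linarith
  have hrc : lam / (theta * (1 - q)) * (1 - q) = lam / theta := by field_simp
  rw [arrivalDensity, Finset.sum_mul, Finset.mul_sum]
  refine Finset.sum_congr rfl fun k hk => ?_
  have hk' : k < i + 1 ∧ k < j := by simpa using hk
  obtain ⟨m, hm⟩ : ∃ m, j - k = m + 1 := ⟨j - k - 1, by omega⟩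
  rw [hm, show j + 1 - 2 - k = m by omega, coeff_succ_arrivalSeries_eq_sum (by linarith)
    (by linarith) (Real.exp_pos _).le, hrc, sub_sub_cancel]
  simp only [Finset.mul_sum, Finset.sum_mul]
  refine Finset.sum_congr rfl fun l _ => ?_
  -- Queue states i, j stand for volumes i + 1, j + 1. The factor 1 - x of the arrival coefficient
  -- raises the exponent i - k to (i + 1) - k.
  rw [integrandArrival_eq, show i + 1 - k = i - k + 1 by omega, pow_succ, pow_add]
  ring

theorem integrableOn_arrivalDensity (hq : 0 < q) (hq' : q < 1) (htheta : 0 < theta)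
    (hbeta : 0 < beta) (i j : ℕ) :
    IntegrableOn (arrivalDensity (lam / (theta * (1 - q))) (1 - q) theta beta i j) (Ioi 0) := by
  simp only [funext (arrivalDensity_eq_sum (lam := lam) (beta := beta) hq hq' htheta i j)]
  refine (integrable_finsetSum _ fun k _ => (integrable_finsetSum _ fun l _ => ?_).const_mul _
    ).const_mul _
  exact (integrableOn_integrandArrival lam htheta hbeta hq hq' _ _ _).const_mul _

theorem arrivalTerm_eq_integral (hq : 0 < q) (hq' : q < 1) (htheta : 0 < theta)
    (hbeta : 0 < beta) (i j : ℕ) : arrivalTerm lam theta q beta (j + 1) (i + 1) =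
      ∫ t in Ioi (0 : ℝ), arrivalDensity (lam / (theta * (1 - q))) (1 - q) theta beta i j t := by
  have hint := integrableOn_integrandArrival lam htheta hbeta hq hq'
  simp only [arrivalDensity_eq_sum hq hq' htheta]
  rw [integral_const_mul, integral_finsetSum _ fun k _ =>
    (integrable_finsetSum _ fun l _ => (hint _ _ _).const_mul _).const_mul _]
  simp only [integral_const_mul]
  rw [arrivalTerm]
  simp only [Nat.add_sub_cancel]
  congr 1
  refine Finset.sum_congr rfl fun k _ => ?_
  rw [integral_finsetSum _ fun l _ => (hint _ _ _).const_mul _]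
  simp only [integral_const_mul]

theorem integrandSurvival_nonneg (hq : 0 < q) (hq' : q < 1) (htheta : 0 < theta) (i : ℕ) {j : ℕ}
    (hj : 1 ≤ j) {t : ℝ} (ht : 0 ≤ t) : 0 ≤ integrandSurvival lam theta q beta i j t := by
  rw [integrandSurvival_eq _ _ _ _ _ hj]
  have h1 : 0 ≤ 1 - Real.exp (-theta * t) := by linarith [exp_neg_mul_le_one htheta ht]
  have h2 : 0 ≤ 1 - q := by linarith
  positivity

/-- The defining sum alternates; its sign is visible only from the integral of a transition density.
-/
theorem arrivalTerm_nonneg (hlam : 0 < lam) (hq : 0 < q) (hq' : q < 1) (htheta : 0 < theta)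
    (hbeta : 0 < beta) (i j : ℕ) : 0 ≤ arrivalTerm lam theta q beta (j + 1) (i + 1) := by
  rw [arrivalTerm_eq_integral hq hq' htheta hbeta]
  have : 0 < 1 - q := by linarith
  exact setIntegral_nonneg measurableSet_Ioi fun t ht =>
    arrivalDensity_nonneg (by positivity) (by linarith) (by linarith) htheta (le_of_lt ht) i j

theorem survivalTerm_nonneg (hq : 0 < q) (hq' : q < 1) (htheta : 0 < theta) (i : ℕ) {j : ℕ}
    (hj : 1 ≤ j) : 0 ≤ survivalTerm lam theta q beta j i :=
  mul_nonneg (Nat.cast_nonneg _) (setIntegral_nonneg measurableSet_Ioi fun _ ht =>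
    integrandSurvival_nonneg hq hq' htheta i hj (le_of_lt ht))

theorem integral_kernel_mul_exp (hq : 0 < q) (hq' : q < 1) (htheta : 0 < theta) (hbeta : 0 < beta)
    (i j : ℕ) : ∫ t in Ioi (0 : ℝ), kernel (lam / (theta * (1 - q))) (1 - q)
        (Real.exp (-theta * t)) i j * Real.exp (-beta * t)
      = arrivalTerm lam theta q beta (j + 1) (i + 1)
        + survivalTerm lam theta q beta (j + 1) (i + 1) := by
  simp only [kernel_mul_exp_eq]
  rw [integral_add (integrableOn_arrivalDensity hq hq' htheta hbeta i j)
    ((integrableOn_integrandSurvival lam htheta hbeta hq hq' (i + 1) (by omega)).const_mul _),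
    arrivalTerm_eq_integral hq hq' htheta hbeta, survivalTerm, integral_const_mul,
    Nat.add_sub_cancel, Nat.add_sub_cancel]

end Formula

theorem hasSum_resetStationary {S : Type} [DecidableEq S] [Countable S] {A : S → S → ℝ}
    {P : ℝ≥0 → S → S → ℝ} {h : S → ℝ} {β : ℝ} (hP : IsTransitionFunction A P)
    (hA : IsConservative A) (hh : IsDistribution h) (hβ : 0 < β) (j : S) :
    HasSum (fun i => h i * (β * ∫ s in Ioi (0 : ℝ), P s.toNNReal i j * Real.exp (-β * s)))
      (resetStationary P h β j) := by
  have := hasSum_integral_of_nonneg (μ := volume.restrict (Ioi (0 : ℝ)))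
    (F := fun i s => β * Real.exp (-β * s) * (h i * P s.toNNReal i j))
    (G := ageDensity P h β j)
    (fun i => ?_) (ae_of_all _ fun s i => ?_) (integrableOn_ageDensity hP hA hh hβ j 0)
    (ae_of_all _ fun s => ?_)
  · refine this.of_forall_eq fun i => ?_
    rw [← integral_const_mul, ← integral_const_mul]
    congr 1
    funext s
    ring
  · have := (hP.continuous hA i j).comp continuous_real_toNNReal
    exact (Continuous.mul (by fun_prop) (this.const_mul _)).aestronglyMeasurable
  · exact mul_nonneg (by positivity) (mul_nonneg (hh.nonneg i) ((hP.stochastic _ i).nonneg j))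
  · exact (summable_mul_of_abs_le hh.hasSum_one.summable
      fun i => (hP.stochastic _ i).abs_le_one j).hasSum.mul_left _

/-- Transition function of the volume of a limit. -/
def limitTransition (lam theta q : ℝ) (t : ℝ≥0) (i j : ℕ+) : ℝ :=
  queueTransition (lam / (theta * (1 - q))) (1 - q) theta t i.natPred j.natPred

/-! ### Transfer from the queue on ℕ to volumes on ℕ+ -/

section Limit

variable {lam theta q : ℝ}

theorem isConservative_limitGenerator (hlam : 0 < lam) (htheta : 0 < theta) (hq : 0 < q)
    (hq' : q < 1) : IsConservative (limitGenerator lam 0 theta (geometricSize q)) :=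
  (isConservative_queueGenerator hlam.le htheta.le hq hq').comap Equiv.pnatEquivNat

theorem isLyapunov_limitGenerator (hlam : 0 < lam) (htheta : 0 < theta) (hq : 0 < q)
    (hq' : q < 1) : IsLyapunov (limitGenerator lam 0 theta (geometricSize q))
      (fun i => (i.natPred : ℝ) + 1) (lam / q) :=
  (isLyapunov_queueGenerator hlam.le htheta.le hq hq').comap Equiv.pnatEquivNat

theorem isTransitionFunction_limitTransition (hlam : 0 < lam) (htheta : 0 < theta) (hq : 0 < q)
    (hq' : q < 1) : IsTransitionFunction (limitGenerator lam 0 theta (geometricSize q))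
      (limitTransition lam theta q) := by
  have hc : 0 < 1 - q := by linarith
  have h := isTransitionFunction_queueTransition (r := lam / (theta * (1 - q))) (by positivity) hc
    (by linarith) htheta
  have e : lam / (theta * (1 - q)) * (1 - q) * theta = lam := by field_simp
  rw [e, sub_sub_cancel] at h
  exact h.comap Equiv.pnatEquivNat

theorem isStationary_limitTransition_iff (hlam : 0 < lam) (htheta : 0 < theta) (hq : 0 < q)
    (hq' : q < 1) (ν : ℕ+ → ℝ) : IsStationary (limitTransition lam theta q) ν ↔
      ν = fun i => polya (lam / (theta * (1 - q))) q i.natPred := by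
  have hc : 0 < 1 - q := by linarith
  have hr : 0 < lam / (theta * (1 - q)) := by positivity
  have hpi : (fun i : ℕ+ => polya (lam / (theta * (1 - q))) q i.natPred)
      = fun i => kernel (lam / (theta * (1 - q))) (1 - q) 0 0 i.natPred :=
    funext fun i => (kernel_zero_eq_polya hr 0 _).symm
  have hs : IsStationary (limitTransition lam theta q)
      fun i => kernel (lam / (theta * (1 - q))) (1 - q) 0 0 i.natPred :=
    (isStationary_queueTransition hr hc (by linarith) htheta).comap Equiv.pnatEquivNat
  rw [hpi]
  exact isStationary_iff_of_tendsto (isTransitionFunction_limitTransition hlam htheta hq hq') hs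
    (fun i j => tendsto_queueTransition hc (by linarith) htheta i.natPred j.natPred) ν

theorem transitionFunction_limitGenerator_reset_unique {β : ℝ} {h : ℕ+ → ℝ}
    {P P' : ℝ≥0 → ℕ+ → ℕ+ → ℝ} (hlam : 0 < lam) (htheta : 0 < theta) (hq : 0 < q) (hq' : q < 1)
    (hβ : 0 ≤ β) (hh : IsDistribution h)
    (hP : IsTransitionFunction
      (resetGenerator (limitGenerator lam 0 theta (geometricSize q)) β h) P)
    (hP' : IsTransitionFunction
      (resetGenerator (limitGenerator lam 0 theta (geometricSize q)) β h) P') : P = P' :=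
  (isLyapunov_limitGenerator hlam htheta hq hq').transitionFunction_unique (by positivity)
    (isConservative_limitGenerator hlam htheta hq hq') hβ hh hP hP'

theorem hasSum_stationary_bestQuote {β : ℝ} {h : ℕ+ → ℝ} (hlam : 0 < lam) (htheta : 0 < theta)
    (hq : 0 < q) (hq' : q < 1) (hβ : 0 < β) (hh : IsDistribution h) (j : ℕ+) :
    HasSum (fun i : ℕ+ => h i * (β * (arrivalTerm lam theta q β j i
      + survivalTerm lam theta q β j i)))
      (resetStationary (limitTransition lam theta q) h β j) := by
  refine (hasSum_resetStationary (isTransitionFunction_limitTransition hlam htheta hq hq')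
    (isConservative_limitGenerator hlam htheta hq hq') hh hβ j).of_forall_eq fun i => ?_
  have h1 := integral_kernel_mul_exp (lam := lam) hq hq' htheta hβ i.natPred j.natPred
  rw [PNat.natPred_add_one, PNat.natPred_add_one] at h1
  rw [← h1]
  congr 2
  refine setIntegral_congr_fun measurableSet_Ioi fun s hs => ?_
  simp only [limitTransition, queueTransition]
  rw [Real.coe_toNNReal _ (le_of_lt hs)]

end Limit

theorem isDistribution_resetDistribution {lam0 muA : ℝ} {g0 pi2 : ℕ+ → ℝ} (hlam0 : 0 ≤ lam0)
    (hmuA : 0 ≤ muA) (hbeta : 0 < lam0 + muA) (hg0 : IsDistribution g0)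
    (hpi2 : IsDistribution pi2) : IsDistribution (resetDistribution lam0 muA g0 pi2) where
  nonneg i := add_nonneg (div_nonneg (mul_nonneg hlam0 (hg0.nonneg i)) hbeta.le)
    (div_nonneg (mul_nonneg hmuA (hpi2.nonneg i)) hbeta.le)
  hasSum_one := by
    have := ((hg0.hasSum_one.mul_left lam0).div_const (lam0 + muA)).add
      ((hpi2.hasSum_one.mul_left muA).div_const (lam0 + muA))
    rwa [mul_one, mul_one, ← add_div, div_self hbeta.ne'] at this

/-- Superposition of two reset clocks: the rates add and the reset laws mix in proportion to the
rates. -/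
theorem bestQuoteGenerator_eq_resetGenerator {lam0 muA : ℝ} (hbeta : 0 < lam0 + muA)
    (A : ℕ+ → ℕ+ → ℝ) (g0 pi2 : ℕ+ → ℝ) : bestQuoteGenerator A lam0 muA g0 pi2 =
      resetGenerator A (lam0 + muA) (resetDistribution lam0 muA g0 pi2) := by
  funext i j
  simp only [bestQuoteGenerator, resetGenerator, resetDistribution]
  field_simp
  ring

end OrderBook

end

/-! ### Assembly of the proposition -/

theorem mainTheorem3 (lam0 lam1 lam2 muA theta1 theta2 q1 q2 : ℝ) (g0 : ℕ+ → ℝ)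
    (hlam0 : 0 ≤ lam0) (hmuA : 0 ≤ muA) (hbeta : 0 < lam0 + muA)
    (hlam1 : 0 < lam1) (hlam2 : 0 < lam2) (htheta1 : 0 < theta1) (htheta2 : 0 < theta2)
    (hq1 : 0 < q1) (hq1' : q1 < 1) (hq2 : 0 < q2) (hq2' : q2 < 1)
    (hg0 : OrderBook.IsDistribution g0) :
    ∃ (P2 P : ℝ≥0 → ℕ+ → ℕ+ → ℝ) (pi2 pi h : ℕ+ → ℝ),
      -- the volume at the second limit: its law, its unique stationary distribution `pi2`
      (∀ P', OrderBook.IsTransitionFunction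
        (OrderBook.limitGenerator lam2 0 theta2 (OrderBook.geometricSize q2)) P' ↔ P' = P2) ∧
      (∀ ν, OrderBook.IsStationary P2 ν ↔ ν = pi2) ∧
      (∀ i : ℕ+, pi2 i = OrderBook.polya (lam2 / ((1 - q2) * theta2)) q2 ((i : ℕ) - 1)) ∧
      -- the volume at the best quote: its law, its unique stationary distribution `pi`
      (∀ P', OrderBook.IsTransitionFunction
        (OrderBook.bestQuoteGenerator
          (OrderBook.limitGenerator lam1 0 theta1 (OrderBook.geometricSize q1))
          lam0 muA g0 pi2) P' ↔ P' = P) ∧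
      (∀ ν, OrderBook.IsStationary P ν ↔ ν = pi) ∧
      -- the distribution `h` after a price move
      (∀ i, h i = OrderBook.resetDistribution lam0 muA g0 pi2 i) ∧
      (∀ i : ℕ+, h i = lam0 * g0 i / (muA + lam0)
        + muA / (muA + lam0) * q2 ^ (lam2 / ((1 - q2) * theta2))
          * ((1 - q2) ^ ((i : ℕ) - 1) / (((i : ℕ) - 1).factorial : ℝ))
          * (Real.Gamma ((i : ℝ) - 1 + lam2 / ((1 - q2) * theta2))
            / Real.Gamma (lam2 / ((1 - q2) * theta2)))) ∧
      -- the integrals and series in the formula for `pi` converge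
      (∀ i k l : ℕ, MeasureTheory.IntegrableOn
        (OrderBook.integrandArrival lam1 theta1 q1 (lam0 + muA) i k l) (Set.Ioi 0)) ∧
      (∀ i j : ℕ, 1 ≤ j → MeasureTheory.IntegrableOn
        (OrderBook.integrandSurvival lam1 theta1 q1 (lam0 + muA) i j) (Set.Ioi 0)) ∧
      (∀ j : ℕ+, Summable fun i : ℕ+ =>
        h i * OrderBook.arrivalTerm lam1 theta1 q1 (lam0 + muA) j i) ∧
      (∀ j : ℕ+, Summable fun i : Set.Ici j =>
        h i * OrderBook.survivalTerm lam1 theta1 q1 (lam0 + muA) j (i : ℕ+)) ∧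
      -- the formula
      (∀ j : ℕ+, pi j = (lam0 + muA) *
        ((∑' i : ℕ+, h i * OrderBook.arrivalTerm lam1 theta1 q1 (lam0 + muA) j i)
          + ∑' i : Set.Ici j,
            h i * OrderBook.survivalTerm lam1 theta1 q1 (lam0 + muA) j (i : ℕ+))) := by
  open OrderBook in
  set β := lam0 + muA with hβ
  set pi2 : ℕ+ → ℝ := fun i => polya (lam2 / (theta2 * (1 - q2))) q2 i.natPred with hpi2
  set h := resetDistribution lam0 muA g0 pi2 with hh
  have hP2 := isTransitionFunction_limitTransition hlam2 htheta2 hq2 hq2'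
  have hP1 := isTransitionFunction_limitTransition hlam1 htheta1 hq1 hq1'
  have hA1 := isConservative_limitGenerator hlam1 htheta1 hq1 hq1'
  have hstat2 := isStationary_limitTransition_iff hlam2 htheta2 hq2 hq2'
  have hhd : IsDistribution h := isDistribution_resetDistribution hlam0 hmuA hbeta hg0
    ((hstat2 pi2).2 rfl).distribution
  have hPX := isTransitionFunction_resetTransition hP1 hA1 hhd hbeta
  have hr : lam2 / (theta2 * (1 - q2)) = lam2 / ((1 - q2) * theta2) := by rw [mul_comm theta2]
  have harr : ∀ i j : ℕ+, 0 ≤ arrivalTerm lam1 theta1 q1 β j i := fun i j => by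
    have := arrivalTerm_nonneg hlam1 hq1 hq1' htheta1 hbeta i.natPred j.natPred
    rwa [PNat.natPred_add_one, PNat.natPred_add_one] at this
  have hsur : ∀ i j : ℕ+, 0 ≤ survivalTerm lam1 theta1 q1 β j i := fun i j =>
    survivalTerm_nonneg hq1 hq1' htheta1 i j.2
  have hsum := hasSum_stationary_bestQuote hlam1 htheta1 hq1 hq1' hbeta hhd
  have hsum' : ∀ j : ℕ+, HasSum (fun i : ℕ+ => h i * arrivalTerm lam1 theta1 q1 β j i
      + h i * survivalTerm lam1 theta1 q1 β j i)
      (resetStationary (limitTransition lam1 theta1 q1) h β j / β) := fun j =>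
    ((hsum j).div_const β).of_forall_eq fun i => by field_simp
  -- Both parts are nonnegative, so the convergence of their joint series, known from the stationary
  -- law, gives that of each.
  have hsumA : ∀ j : ℕ+, Summable fun i : ℕ+ => h i * arrivalTerm lam1 theta1 q1 β j i := fun j =>
    Summable.of_nonneg_of_le (fun i => mul_nonneg (hhd.nonneg i) (harr i j))
      (fun i => le_add_of_nonneg_right (mul_nonneg (hhd.nonneg i) (hsur i j))) (hsum' j).summable
  have hsumS : ∀ j : ℕ+, Summable fun i : ℕ+ => h i * survivalTerm lam1 theta1 q1 β j i := fun j =>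
    Summable.of_nonneg_of_le (fun i => mul_nonneg (hhd.nonneg i) (hsur i j))
      (fun i => le_add_of_nonneg_left (mul_nonneg (hhd.nonneg i) (harr i j))) (hsum' j).summable
  refine ⟨limitTransition lam2 theta2 q2, resetTransition (limitTransition lam1 theta1 q1) h β, pi2,
    resetStationary (limitTransition lam1 theta1 q1) h β, h, fun P' => ⟨fun hP' => ?_, ?_⟩, hstat2,
    fun i => ?_, fun P' => ⟨fun hP' => ?_, ?_⟩,
    isStationary_resetTransition_iff hP1 hA1 hhd hbeta, fun i => rfl, fun i => ?_,
    integrableOn_integrandArrival lam1 htheta1 hbeta hq1 hq1',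
    fun i j hj => integrableOn_integrandSurvival lam1 htheta1 hbeta hq1 hq1' i hj, hsumA,
    fun j => (hsumS j).subtype _, fun j => ?_⟩
  -- The second limit has no resets: the uniqueness result is used with rate 0, for which any reset
  -- law serves.
  · have e : limitGenerator lam2 0 theta2 (geometricSize q2)
        = resetGenerator (limitGenerator lam2 0 theta2 (geometricSize q2)) 0 g0 := by
      funext i j; simp [resetGenerator]
    rw [e] at hP' hP2
    exact transitionFunction_limitGenerator_reset_unique hlam2 htheta2 hq2 hq2' le_rfl hg0 hP' hP2
  · rintro rfl; exact hP2
  · simp only [hpi2, hr, PNat.natPred]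
  · rw [bestQuoteGenerator_eq_resetGenerator hbeta] at hP'
    exact transitionFunction_limitGenerator_reset_unique hlam1 htheta1 hq1 hq1' hbeta.le hhd hP' hPX
  · rintro rfl
    rw [bestQuoteGenerator_eq_resetGenerator hbeta]
    exact hPX
  · simp only [hh, resetDistribution, hpi2, polya, hr, PNat.natPred]
    rw [Nat.cast_sub (show 1 ≤ (i : ℕ) from i.2), Nat.cast_one, add_comm muA]
    ring
  -- For i < j the binomial coefficient vanishes, so the restricted series may be taken over all i
  -- and merged with the first.
  · have h1 : ∑' i : Set.Ici j, h i * survivalTerm lam1 theta1 q1 β j (i : ℕ+)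
        = ∑' i : ℕ+, h i * survivalTerm lam1 theta1 q1 β j i := by
      refine tsum_subtype_eq_of_support_subset
        (f := fun i : ℕ+ => h i * survivalTerm lam1 theta1 q1 β j i) fun i hi => ?_
      by_contra hij
      have hlt : (i : ℕ) < j := lt_of_not_ge hij
      refine hi ?_
      have hi1 : 1 ≤ (i : ℕ) := i.2
      simp [survivalTerm, Nat.choose_eq_zero_of_lt (show (i : ℕ) - 1 < j - 1 by omega)]
    rw [h1, ← (hsumA j).tsum_add (hsumS j), (hsum' j).tsum_eq]
    field_simp
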